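/- For a symmetric matrix $\theta\in\mathbb R^{p\times p}$ let $f_\theta(x)\propto\exp\big(\sum_j\theta_{jj}x_j+\sum_{i<j}\theta_{ij}x_ix_j\big)$, $x\in\{0,1\}^p$, be the Ising probability mass function. Let the rows of $Z\in\{0,1\}^{n\times p}$ be i.i.d. with law $f_{\theta_\star}$, $\theta_\star$ symmetric, and write $\mathbb E^{(n)}$ for the expectation over $Z$. Let $$q_{n,\theta}(Z)=\prod_{j=1}^p\prod_{i=1}^n\frac{\exp\big(Z_{ij}(\theta_{jj}+\sum_{k\ne j}\theta_{kj}Z_{ik})\big)}{1+\exp\big(\theta_{jj}+\sum_{k\neq j}\theta_{kj}Z_{ik}\big)},\qquad\theta\in\mathbb R^{p\times p},$$ and let $\check\Pi(\cdot\mid Z)$ be the probability measure on $\mathbb R^{p\times p}$ given by $$\check\Pi(d\theta\mid Z)\propto q_{n,\theta}(Z)\prod_{j=1}^p\sum_{\delta\in\{0,1\}^p}\pi_\delta\Big(\frac\rho2\Big)^{\|\delta\|_0}e^{-\rho\|\theta_{\cdot j}\|_1}\mu_{p,\delta}(d\theta_{\cdot j}),\qquad \rho=24\sqrt{n\log p},$$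 where $\theta_{\cdot j}$ is the $j$-th column, $\|\cdot\|_0$ counts nonzero coordinates, and $\mu_{p,\delta}$ is the product over $k$ of Lebesgue measure on $\mathbb R$ (if $\delta_k=1$) or the Dirac mass at $0$ (if $\delta_k=0$). The prior weights are $\pi_\delta=g_{\|\delta\|_0}\binom p{\|\delta\|_0}^{-1}$, where $g$ is a probability distribution on $\{0,\dots,p\}$ with $c_1p^{-c_3}g_{s-1}\le g_s\le c_2p^{-c_4}g_{s-1}$ for $1\le s\le p$, and $c_1,c_2>0$, $c_3\ge c_4>0$ are constants. With $g(x)=\log(1+e^x)$ (the logistic function, not the distribution above), $X\sim f_{\theta_\star}$, and $X_{(j)}$ the vector $X$ with $j$-th coordinate replaced by $1$, let $\mathcal H^{(j)}=\mathbb E\big[g''(\langle\theta_{\star\cdot j},X_{(j)}\rangle)X_{(j)}X_{(j)}'\big]$ and $$\underline\kappa_2(s)=\min_j\inf\Big\{\frac{u'\mathcal H^{(j)}u}{\|u\|_2^2}:u\ne0,\ \|u\|_0\le s\Big\},\qquad \underline\kappa_2=\min_j\inf\Big\{\frac{u'\mathcal H^{(j)}u}{\|u\|_2^2}:u\ne0,\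 \sum_{k:\theta_{\star kj}=0}|u_k|\le7\sum_{k:\theta_{\star kj}\ne0}|u_k|\Big\}$$ (with $\inf\emptyset=+\infty$). Put $s_{\star j}=\|\theta_{\star\cdot j}\|_0$, $$\zeta_j=s_{\star j}+\frac4{c_4}+\frac2{c_4}\Big(1+\frac{4608}{\underline\kappa_2}+\frac{s_{\star j}}{64(\log p)^2}+\frac{\log(4e)}{\log p}\Big)s_{\star j},\qquad \bar s_j=\lceil s_{\star j}+\zeta_j\rceil,\qquad \bar s=\max_j\bar s_j,$$ and $\underline\kappa=\min(\underline\kappa_2,\underline\kappa_2(\bar s))$. There are universal constants $A_1,A_2>0$ such that, for all constants $c_1,\dots,c_4$ as above, there are $M_0>2$ and $p_0$, depending only on $c_1,\dots,c_4$, with the following property. For all $p\ge p_0$, all such $\pi$ and $\theta_\star$ with $\underline\kappa>0$, and all $$n\ge A_1\Big(\frac1{\underline\kappa}\sum_{j=1}^p\bar s_j\Big)^2\log p,$$ 1. $\displaystyle\mathbb E^{(n)}\big[\check\Pi\big(\{\theta:\|\theta_{\cdot j}\|_0>\zeta_j\text{ for some }j\}\mid Z\big)\big]\le e^{-A_2n}+\frac4p$;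 2. $\displaystyle\mathbb E^{(n)}\Big[\check\Pi\Big(\Big\{\theta:\|\theta-\theta_\star\|_F>\frac{M_0}{\underline\kappa_2(\bar s)}\sqrt{\Big(\sum_{j=1}^p\bar s_j\Big)\frac{\log p}n}\Big\}\,\Big|\,Z\Big)\Big]\le2e^{-A_2n}+\frac{12}p$. -/

import Mathlib

open MeasureTheory ProbabilityTheory
open scoped ENNReal Matrix

noncomputable section

namespace IsingQP

/-! ### The Ising model and its column-wise Fisher information -/

/-- The unnormalised weight `exp (∑ⱼ θⱼⱼ xⱼ + ∑_{i<j} θᵢⱼ xᵢ xⱼ)` of `x ∈ {0,1}^p`. -/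
def isingWeight {p : ℕ} (θ : Matrix (Fin p) (Fin p) ℝ) (x : Fin p → Fin 2) : ℝ :=
  Real.exp (∑ j, θ j j * ((x j).val : ℝ) +
    ∑ j, ∑ i with i < j, θ i j * ((x i).val : ℝ) * ((x j).val : ℝ))

/-- The Ising probability mass function `f_θ` on `{0,1}^p`. -/
def isingPMF {p : ℕ} (θ : Matrix (Fin p) (Fin p) ℝ) (x : Fin p → Fin 2) : ℝ :=
  isingWeight θ x / ∑ y, isingWeight θ y

/-- The number of nonzero coordinates `‖u‖₀`. -/
def l0 {p : ℕ} (u : Fin p → ℝ) : ℕ := (Finset.univ.filter fun k => u k ≠ 0).card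

/-- The logistic log-partition function `g(x) = log (1 + eˣ)`. -/
def logPartition (x : ℝ) : ℝ := Real.log (1 + Real.exp x)

/-- The vector `x_(j)`: `x` as a real vector, with its `j`-th coordinate replaced by `1`. -/
def withIntercept {p : ℕ} (j : Fin p) (x : Fin p → Fin 2) : Fin p → ℝ :=
  Function.update (fun k => ((x k).val : ℝ)) j 1

/-- `H^(j) = E[g''(⟨θ_{·j}, X_(j)⟩) X_(j) X_(j)ᵀ]` for `X ∼ f_θ`. -/
def fisher {p : ℕ} (θ : Matrix (Fin p) (Fin p) ℝ) (j : Fin p) : Matrix (Fin p) (Fin p) ℝ :=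
  ∑ x : Fin p → Fin 2,
    (isingPMF θ x * iteratedDeriv 2 logPartition (∑ k, θ k j * withIntercept j x k)) •
      Matrix.vecMulVec (withIntercept j x) (withIntercept j x)

/-- The Rayleigh quotient `uᵀ H^(j) u / ‖u‖₂²`. It is nonnegative because `H^(j)` is positive
semidefinite, so that it is viewed in `[0, ∞]`, where the infimum of the empty set is `∞`. -/
def rayleigh {p : ℕ} (θ : Matrix (Fin p) (Fin p) ℝ) (j : Fin p) (u : Fin p → ℝ) : ℝ≥0∞ :=
  ENNReal.ofReal ((u ⬝ᵥ (fisher θ j *ᵥ u)) / ∑ k, u k ^ 2)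

/-- `κ₂(s)`: the smallest Rayleigh quotient, over all columns, among `s`-sparse vectors. -/
def kappaSparse {p : ℕ} (θ : Matrix (Fin p) (Fin p) ℝ) (s : ℕ) : ℝ≥0∞ :=
  ⨅ (j : Fin p) (u : Fin p → ℝ) (_ : u ≠ 0 ∧ l0 u ≤ s), rayleigh θ j u

/-- `κ₂`: the smallest Rayleigh quotient, over all columns `j`, on the cone of vectors whose
`ℓ¹` norm off the support of `θ_{·j}` is at most `7` times the one on that support. -/
def kappaCone {p : ℕ} (θ : Matrix (Fin p) (Fin p) ℝ) : ℝ≥0∞ :=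
  ⨅ (j : Fin p) (u : Fin p → ℝ)
    (_ : u ≠ 0 ∧ ∑ k with θ k j = 0, |u k| ≤ 7 * ∑ k with θ k j ≠ 0, |u k|), rayleigh θ j u

/-- `s_{⋆j}`: the number of nonzero entries of the `j`-th column. -/
def colSparsity {p : ℕ} (θ : Matrix (Fin p) (Fin p) ℝ) (j : Fin p) : ℕ := l0 fun k => θ k j

/-- The sparsity level `ζ_j` (meaningful when `kappaCone θ > 0`; `4608 / ∞ = 0`). -/
def zeta {p : ℕ} (c₄ : ℝ) (θ : Matrix (Fin p) (Fin p) ℝ) (j : Fin p) : ℝ :=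
  (colSparsity θ j : ℝ) + 4 / c₄ +
    2 / c₄ * (1 + (4608 / kappaCone θ).toReal
      + (colSparsity θ j : ℝ) / (64 * Real.log p ^ 2)
      + Real.log (4 * Real.exp 1) / Real.log p) * (colSparsity θ j : ℝ)

/-- `s̄_j = ⌈s_{⋆j} + ζ_j⌉`. -/
def sbar {p : ℕ} (c₄ : ℝ) (θ : Matrix (Fin p) (Fin p) ℝ) (j : Fin p) : ℕ :=
  ⌈(colSparsity θ j : ℝ) + zeta c₄ θ j⌉₊

/-- `s̄ = max_j s̄_j`. -/
def sbarMax {p : ℕ} (c₄ : ℝ) (θ : Matrix (Fin p) (Fin p) ℝ) : ℕ :=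
  Finset.univ.sup (sbar c₄ θ)

/-- `κ = min (κ₂, κ₂(s̄))`. -/
def kappa {p : ℕ} (c₄ : ℝ) (θ : Matrix (Fin p) (Fin p) ℝ) : ℝ≥0∞ :=
  min (kappaCone θ) (kappaSparse θ (sbarMax c₄ θ))

/-! ### The prior and the quasi-posterior -/

/-- The Borel (product) σ-algebra on real `p × p` matrices. -/
instance matrixMeasurableSpace (p : ℕ) : MeasurableSpace (Matrix (Fin p) (Fin p) ℝ) :=
  inferInstanceAs (MeasurableSpace (Fin p → Fin p → ℝ))

/-- The assumption on the sparsity prior `π` on `{0,1}^p` (an element of `{0,1}^p` is given by the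
set of indices of its ones): `π_δ = g_{|δ|} / (p choose |δ|)` for a probability distribution `g` on
`{0, …, p}` with `c₁ p^{-c₃} g_{s-1} ≤ g_s ≤ c₂ p^{-c₄} g_{s-1}` for `1 ≤ s ≤ p`. -/
def SparsityPrior (c₁ c₂ c₃ c₄ : ℝ) (p : ℕ) (π : Finset (Fin p) → ℝ) : Prop :=
  ∃ g : ℕ → ℝ,
    (∀ s ≤ p, 0 ≤ g s) ∧ ∑ s ∈ Finset.range (p + 1), g s = 1 ∧
    (∀ s, 1 ≤ s → s ≤ p →
      c₁ / (p : ℝ) ^ c₃ * g (s - 1) ≤ g s ∧ g s ≤ c₂ / (p : ℝ) ^ c₄ * g (s - 1)) ∧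
    ∀ δ, π δ = g δ.card / (p.choose δ.card : ℝ)

/-- `μ_{p,δ}`: the product of Lebesgue measures on the coordinates in `δ` and of Dirac masses at
`0` on the others. -/
def slabMeasure {p : ℕ} (δ : Finset (Fin p)) : Measure (Fin p → ℝ) :=
  Measure.pi fun k => if k ∈ δ then (volume : Measure ℝ) else Measure.dirac 0

/-- The prior `∑_δ π_δ (ρ/2)^{|δ|} e^{-ρ‖u‖₁} μ_{p,δ}(du)` of one column. -/
def columnPrior {p : ℕ} (π : Finset (Fin p) → ℝ) (ρ : ℝ) : Measure (Fin p → ℝ) :=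
  ∑ δ : Finset (Fin p), ENNReal.ofReal (π δ) •
    (slabMeasure δ).withDensity fun u =>
      ENNReal.ofReal ((ρ / 2) ^ δ.card * Real.exp (-ρ * ∑ k, |u k|))

/-- The prior on `p × p` matrices with independent columns distributed as `columnPrior`. -/
def matrixPrior {p : ℕ} (π : Finset (Fin p) → ℝ) (ρ : ℝ) :
    Measure (Matrix (Fin p) (Fin p) ℝ) :=
  (Measure.pi fun _ : Fin p => columnPrior π ρ).map fun col => Matrix.of fun k j => col j k

/-- The quasi-likelihood `q_{n,θ}(z)`: the product over the columns `j` of the likelihoods of the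
logistic regressions of the `j`-th column of `z` on the others. -/
def quasiLikelihood {n p : ℕ} (θ : Matrix (Fin p) (Fin p) ℝ) (z : Fin n → Fin p → Fin 2) : ℝ :=
  ∏ j, ∏ i,
    Real.exp (((z i j).val : ℝ) * (θ j j + ∑ k with k ≠ j, θ k j * ((z i k).val : ℝ))) /
      (1 + Real.exp (θ j j + ∑ k with k ≠ j, θ k j * ((z i k).val : ℝ)))

/-- The unnormalised quasi-posterior. -/
def quasiPosteriorUnnorm {n p : ℕ} (π : Finset (Fin p) → ℝ) (ρ : ℝ)
    (z : Fin n → Fin p → Fin 2) : Measure (Matrix (Fin p) (Fin p) ℝ) :=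
  (matrixPrior π ρ).withDensity fun θ => ENNReal.ofReal (quasiLikelihood θ z)

/-- The quasi-posterior distribution on `p × p` matrices given the data `z`. -/
def quasiPosterior {n p : ℕ} (π : Finset (Fin p) → ℝ) (ρ : ℝ)
    (z : Fin n → Fin p → Fin 2) : Measure (Matrix (Fin p) (Fin p) ℝ) :=
  (quasiPosteriorUnnorm π ρ z Set.univ)⁻¹ • quasiPosteriorUnnorm π ρ z

/-- The prior scale `ρ = 24 √(n log p)`. -/
def priorScale (n p : ℕ) : ℝ := 24 * Real.sqrt (n * Real.log p)

/-- The Frobenius norm `√(Tr (AᵀA))`. -/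
def frobNorm {p : ℕ} (A : Matrix (Fin p) (Fin p) ℝ) : ℝ := Real.sqrt (Aᵀ * A).trace

/-- The rows `X i` of the data matrix are independent random vectors in `{0,1}^p` with common
probability mass function `f_θ`. -/
structure IsIsingSample {Ω : Type*} [MeasurableSpace Ω] (P : Measure Ω) {n p : ℕ}
    (θ : Matrix (Fin p) (Fin p) ℝ) (X : Fin n → Ω → Fin p → Fin 2) : Prop where
  measurable : ∀ i, Measurable (X i)
  indep : iIndepFun X P
  law : ∀ i x, P (X i ⁻¹' {x}) = ENNReal.ofReal (isingPMF θ x)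

end IsingQP

end

open IsingQP

/-!
The quasi-likelihood and the prior factor over the columns of `θ`, so the quasi-posterior is a
product of the `p` posteriors of logistic regressions of one node on the others, and it suffices
to bound the posterior mass of a bad set of columns by `exp (-2 log p) = p⁻²`.

By Hoeffding's inequality, with probability at least `1 - 1 / p` every column has a score at the
true parameter bounded by `ρ / 2` and an empirical information matrix close to `H^(j)`. The score
bound lets the Laplace penalty absorb the linear term of the log-likelihood up to `-ρ ‖u - v‖₁ / 4`,
where `v` is the true column, except on the support of `v`; there the curvature takes over, on the
cone of `κ₂` for the first claim and on `s̄`-sparse differences for the second. Integrating the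
remaining `exp (-ρ ‖u - v‖₁ / 4)` against a slab of dimension `|δ|` costs a factor `4 ^ |δ|`, and
the decay of the prior weights makes the sum of `4 ^ |δ| π_δ` over `|δ| > ζ_j` small. The
normalising constant is bounded below by its restriction to the model of `v`, on a box of side of
order `1 / ρ`.
-/

namespace IsingQP

/-! ### The logistic function -/

/-- The variance of a Bernoulli variable with log-odds `a`, which is the second derivative of
`logPartition` at `a`. -/
noncomputable def logisticVariance (a : ℝ) : ℝ := Real.sigmoid a * (1 - Real.sigmoid a)

/-- The Bregman divergence of `logPartition` between `a + h` and `a`. -/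
noncomputable def logisticBregman (a h : ℝ) : ℝ :=
  logPartition (a + h) - logPartition a - Real.sigmoid a * h

lemma sigmoid_eq_exp_div (a : ℝ) : Real.sigmoid a = Real.exp a / (1 + Real.exp a) := by
  rw [Real.sigmoid_def, Real.exp_neg]
  field_simp
  ring

lemma hasDerivAt_logPartition (a : ℝ) : HasDerivAt logPartition (Real.sigmoid a) a := by
  have h : (1 : ℝ) + Real.exp a ≠ 0 := by positivity
  rw [sigmoid_eq_exp_div]
  exact ((Real.hasDerivAt_exp a).const_add 1).log h

lemma iteratedDeriv_two_logPartition : iteratedDeriv 2 logPartition = logisticVariance := by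
  have h : deriv logPartition = Real.sigmoid := funext fun a => (hasDerivAt_logPartition a).deriv
  rw [iteratedDeriv_succ, iteratedDeriv_one, h, Real.deriv_sigmoid]
  rfl

lemma logisticVariance_nonneg (a : ℝ) : 0 ≤ logisticVariance a :=
  mul_nonneg (Real.sigmoid_nonneg a) (sub_nonneg.2 (Real.sigmoid_le_one a))

lemma logisticVariance_le_one (a : ℝ) : logisticVariance a ≤ 1 :=
  mul_le_one₀ (Real.sigmoid_le_one a) (sub_nonneg.2 (Real.sigmoid_le_one a))
    (sub_le_self _ (Real.sigmoid_nonneg a))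

lemma logisticVariance_neg (a : ℝ) : logisticVariance (-a) = logisticVariance a := by
  rw [logisticVariance, Real.sigmoid_neg, sub_sub_cancel, mul_comm, logisticVariance]

lemma logPartition_neg (a : ℝ) : logPartition (-a) = logPartition a - a := by
  have h : 1 + Real.exp a = (1 + Real.exp (-a)) * Real.exp a := by
    rw [add_mul, ← Real.exp_add, neg_add_cancel, Real.exp_zero]
    ring
  rw [logPartition, logPartition, h, Real.log_mul (by positivity) (by positivity), Real.log_exp]
  ring

lemma logisticBregman_neg (a h : ℝ) : logisticBregman (-a) (-h) = logisticBregman a h := by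
  rw [logisticBregman, logisticBregman, ← neg_add, logPartition_neg, logPartition_neg,
    Real.sigmoid_neg]
  ring

lemma hasDerivAt_logisticBregman (a h : ℝ) :
    HasDerivAt (logisticBregman a) (Real.sigmoid (a + h) - Real.sigmoid a) h := by
  have h₁ := ((hasDerivAt_logPartition (a + h)).comp_const_add a h).sub_const (logPartition a)
  have h₂ := (hasDerivAt_id h).const_mul (Real.sigmoid a)
  exact (h₁.sub h₂).congr_deriv (by rw [mul_one])

lemma logisticBregman_zero (a : ℝ) : logisticBregman a 0 = 0 := by
  simp [logisticBregman]

lemma sigmoid_add_sub_le (a : ℝ) {h : ℝ} (hh : 0 ≤ h) :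
    Real.sigmoid (a + h) - Real.sigmoid a ≤ h := by
  have hderiv (x : ℝ) : deriv Real.sigmoid x ≤ 1 := by
    rw [Real.deriv_sigmoid]
    exact logisticVariance_le_one x
  simpa using image_sub_le_mul_sub_of_deriv_le differentiable_sigmoid hderiv
    (le_add_of_nonneg_right hh)

lemma sigmoid_sub_sigmoid (a b : ℝ) :
    Real.sigmoid b - Real.sigmoid a =
      Real.sigmoid b * (1 - Real.sigmoid a) * (1 - Real.exp (-(b - a))) := by
  rw [neg_sub, Real.exp_sub, sigmoid_eq_exp_div, sigmoid_eq_exp_div]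
  field_simp
  ring

lemma logisticVariance_mul_le_sigmoid_add_sub (a : ℝ) {h : ℝ} (hh : 0 ≤ h) :
    logisticVariance a * (1 - Real.exp (-h)) ≤ Real.sigmoid (a + h) - Real.sigmoid a := by
  have hexp : 0 ≤ 1 - Real.exp (-h) := sub_nonneg.2 (Real.exp_le_one_iff.2 (neg_nonpos.2 hh))
  rw [sigmoid_sub_sigmoid, add_sub_cancel_left, logisticVariance]
  gcongr
  · exact sub_nonneg.2 (Real.sigmoid_le_one a)
  · exact le_add_of_nonneg_right hh

lemma nonneg_of_hasDerivAt_nonneg {f f' : ℝ → ℝ} (hf : ∀ x, HasDerivAt f (f' x) x)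
    (h0 : f 0 = 0) (hf' : ∀ x, 0 ≤ x → 0 ≤ f' x) {x : ℝ} (hx : 0 ≤ x) : 0 ≤ f x := by
  have hmono : MonotoneOn f (Set.Ici 0) :=
    monotoneOn_of_hasDerivWithinAt_nonneg (convex_Ici 0)
      (fun y _ => (hf y).continuousAt.continuousWithinAt)
      (fun y _ => (hf y).hasDerivWithinAt) fun y hy => hf' y (interior_subset hy)
  exact h0 ▸ hmono Set.self_mem_Ici hx hx

lemma logisticBregman_le (a h : ℝ) : logisticBregman a h ≤ h ^ 2 / 2 := by
  wlog hh : 0 ≤ h generalizing a h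
  · simpa [logisticBregman_neg] using this (-a) (-h) (by linarith)
  refine sub_nonneg.1 (nonneg_of_hasDerivAt_nonneg
    (f := fun h => h ^ 2 / 2 - logisticBregman a h)
    (f' := fun h => h - (Real.sigmoid (a + h) - Real.sigmoid a)) (fun x => ?_) ?_
    (fun x hx => sub_nonneg.2 (sigmoid_add_sub_le a hx)) hh)
  · exact (((hasDerivAt_pow 2 x).div_const 2).sub (hasDerivAt_logisticBregman a x)).congr_deriv
      (by simp)
  · simp [logisticBregman_zero]

lemma sq_div_two_add_le {h : ℝ} (hh : 0 ≤ h) : h ^ 2 / (2 + h) ≤ Real.exp (-h) - 1 + h := by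
  have hpade : (2 - h) / (2 + h) ≤ Real.exp (-h) := by
    rcases le_or_gt 2 h with h2 | h2
    · exact (div_nonpos_of_nonpos_of_nonneg (by linarith) (by linarith)).trans (Real.exp_nonneg _)
    · have : 0 < 2 - h := by linarith
      have hlog := Real.le_log_one_add_of_nonneg (x := 2 * h / (2 - h)) (by positivity)
      have hx : 2 * (2 * h / (2 - h)) / (2 * h / (2 - h) + 2) = h := by
        field_simp
        ring
      have hy : 1 + 2 * h / (2 - h) = ((2 - h) / (2 + h))⁻¹ := by
        field_simp
        ring
      rw [hx, hy, Real.log_inv] at hlog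
      rw [← Real.log_le_iff_le_exp (by positivity)]
      linarith
  have hsplit : h ^ 2 / (2 + h) = (2 - h) / (2 + h) - 1 + h := by
    field_simp
    ring
  linarith

lemma le_logisticBregman (a h : ℝ) :
    logisticVariance a * (h ^ 2 / (2 + |h|)) ≤ logisticBregman a h := by
  wlog hh : 0 ≤ h generalizing a h
  · simpa [logisticBregman_neg, logisticVariance_neg] using this (-a) (-h) (by linarith)
  have hexp : logisticVariance a * (Real.exp (-h) - 1 + h) ≤ logisticBregman a h := by
    refine sub_nonneg.1 (nonneg_of_hasDerivAt_nonneg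
      (f := fun h => logisticBregman a h - logisticVariance a * (Real.exp (-h) - 1 + h))
      (f' := fun h => Real.sigmoid (a + h) - Real.sigmoid a -
        logisticVariance a * (1 - Real.exp (-h))) (fun x => ?_) ?_
      (fun x hx => sub_nonneg.2 (logisticVariance_mul_le_sigmoid_add_sub a hx)) hh)
    · have hexp := (((hasDerivAt_neg x).exp.sub_const 1).add (hasDerivAt_id x)).const_mul
        (logisticVariance a)
      exact ((hasDerivAt_logisticBregman a x).sub hexp).congr_deriv (by ring)
    · simp [logisticBregman_zero]
  rw [abs_of_nonneg hh]
  exact (mul_le_mul_of_nonneg_left (sq_div_two_add_le hh) (logisticVariance_nonneg a)).trans hexp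

/-! ### Logistic regression -/

section LogisticRegression

variable {ι κ : Type*} [Fintype ι] [Fintype κ] {x : ι → κ → ℝ} {y : ι → ℝ} {u v d : κ → ℝ}

/-- The log-likelihood at `u` of the logistic regression of the responses `y` on the covariates
`x`. -/
noncomputable def logisticLogLik (x : ι → κ → ℝ) (y : ι → ℝ) (u : κ → ℝ) : ℝ :=
  ∑ i, (y i * (u ⬝ᵥ x i) - logPartition (u ⬝ᵥ x i))

/-- The score at `v`, which is the gradient of `logisticLogLik`. -/
noncomputable def logisticScore (x : ι → κ → ℝ) (y : ι → ℝ) (v : κ → ℝ) : κ → ℝ :=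
  ∑ i, (y i - Real.sigmoid (v ⬝ᵥ x i)) • x i

/-- The observed information at `v`, which is minus the Hessian of `logisticLogLik`. -/
noncomputable def logisticInfo (x : ι → κ → ℝ) (v : κ → ℝ) : Matrix κ κ ℝ :=
  ∑ i, logisticVariance (v ⬝ᵥ x i) • Matrix.vecMulVec (x i) (x i)

/-- The logarithm of the likelihood times the Laplace prior density `exp (-ρ‖u‖₁)`. -/
noncomputable def penalizedLogLik (x : ι → κ → ℝ) (y : ι → ℝ) (ρ : ℝ) (u : κ → ℝ) : ℝ :=
  logisticLogLik x y u - ρ * ∑ k, |u k|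

lemma logisticLogLik_sub (x : ι → κ → ℝ) (y : ι → ℝ) (u v : κ → ℝ) :
    logisticLogLik x y u - logisticLogLik x y v =
      logisticScore x y v ⬝ᵥ (u - v) - ∑ i, logisticBregman (v ⬝ᵥ x i) ((u - v) ⬝ᵥ x i) := by
  simp only [logisticScore, logisticLogLik, logisticBregman, sum_dotProduct,
    ← Finset.sum_sub_distrib, sub_dotProduct, smul_dotProduct, smul_eq_mul,
    dotProduct_sub]
  refine Finset.sum_congr rfl fun i _ => ?_
  rw [dotProduct_comm (x i) u, dotProduct_comm (x i) v, add_sub_cancel]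
  ring

lemma dotProduct_logisticInfo_mulVec (x : ι → κ → ℝ) (v d : κ → ℝ) :
    d ⬝ᵥ (logisticInfo x v *ᵥ d) = ∑ i, logisticVariance (v ⬝ᵥ x i) * (d ⬝ᵥ x i) ^ 2 := by
  simp only [logisticInfo, Matrix.sum_mulVec, dotProduct_sum, Matrix.smul_mulVec,
    dotProduct_smul, Matrix.vecMulVec_mulVec, smul_eq_mul]
  refine Finset.sum_congr rfl fun i _ => ?_
  rw [dotProduct_comm (x i) d, sq, op_smul_eq_mul]

lemma abs_dotProduct_le {R : ℝ} (hd : ∀ k, |d k| ≤ R) :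
    |d ⬝ᵥ u| ≤ R * ∑ k, |u k| := by
  rw [Finset.mul_sum]
  refine (Finset.abs_sum_le_sum_abs _ _).trans (Finset.sum_le_sum fun k _ => ?_)
  rw [abs_mul]
  exact mul_le_mul_of_nonneg_right (hd k) (abs_nonneg _)

lemma abs_dotProduct_le_of_abs_le_one (hd : ∀ k, |d k| ≤ 1) : |u ⬝ᵥ d| ≤ ∑ k, |u k| := by
  simpa [dotProduct_comm u d] using abs_dotProduct_le (u := u) hd

lemma le_logisticLogLik {R : ℝ} (hx : ∀ i k, |x i k| ≤ 1) (hR : ∀ k, |logisticScore x y v k| ≤ R) :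
    logisticLogLik x y v - R * ∑ k, |(u - v) k| - Fintype.card ι * (∑ k, |(u - v) k|) ^ 2 / 2 ≤
      logisticLogLik x y u := by
  have hscore := (abs_le.1 (abs_dotProduct_le (u := u - v) hR)).1
  have hbregman : ∑ i, logisticBregman (v ⬝ᵥ x i) ((u - v) ⬝ᵥ x i) ≤
      ∑ _i : ι, (∑ k, |(u - v) k|) ^ 2 / 2 := by
    refine Finset.sum_le_sum fun i _ => (logisticBregman_le _ _).trans ?_
    gcongr ?_ / 2
    exact sq_le_sq' (abs_le.1 (abs_dotProduct_le_of_abs_le_one (hx i))).1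
      (abs_le.1 (abs_dotProduct_le_of_abs_le_one (hx i))).2
  rw [Finset.sum_const, Finset.card_univ, nsmul_eq_mul, ← mul_div_assoc] at hbregman
  linarith [logisticLogLik_sub x y u v]

lemma logisticLogLik_le {R : ℝ} (hx : ∀ i k, |x i k| ≤ 1) (hR : ∀ k, |logisticScore x y v k| ≤ R) :
    logisticLogLik x y u ≤ logisticLogLik x y v + R * ∑ k, |(u - v) k| -
      ((u - v) ⬝ᵥ (logisticInfo x v *ᵥ (u - v))) / (2 + ∑ k, |(u - v) k|) := by
  have hscore := (abs_le.1 (abs_dotProduct_le (u := u - v) hR)).2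
  have hbregman : ((u - v) ⬝ᵥ (logisticInfo x v *ᵥ (u - v))) / (2 + ∑ k, |(u - v) k|) ≤
      ∑ i, logisticBregman (v ⬝ᵥ x i) ((u - v) ⬝ᵥ x i) := by
    rw [dotProduct_logisticInfo_mulVec, Finset.sum_div]
    refine Finset.sum_le_sum fun i _ => le_trans ?_ (le_logisticBregman _ _)
    rw [mul_div_assoc]
    refine mul_le_mul_of_nonneg_left ?_ (logisticVariance_nonneg _)
    gcongr
    exact abs_dotProduct_le_of_abs_le_one (hx i)
  linarith [logisticLogLik_sub x y u v]

lemma sum_support_add_sum_compl (v d : κ → ℝ) :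
    ∑ k with v k ≠ 0, |d k| + ∑ k with v k = 0, |d k| = ∑ k, |d k| := by
  rw [add_comm]
  exact Finset.sum_filter_add_sum_filter_not _ _ _

lemma sum_abs_sub_le (u v : κ → ℝ) :
    ∑ k, |v k| + ∑ k with v k = 0, |(u - v) k| ≤ ∑ k, |u k| + ∑ k with v k ≠ 0, |(u - v) k| := by
  have hoff : ∑ k with v k = 0, |(u - v) k| = ∑ k with v k = 0, |u k| :=
    Finset.sum_congr rfl fun k hk => by simp [(Finset.mem_filter.1 hk).2]
  have hon : ∑ k with v k ≠ 0, |v k| ≤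
      ∑ k with v k ≠ 0, |u k| + ∑ k with v k ≠ 0, |(u - v) k| := by
    rw [← Finset.sum_add_distrib]
    refine Finset.sum_le_sum fun k _ => ?_
    rw [Pi.sub_apply, abs_sub_comm]
    linarith [abs_sub_abs_le_abs_sub (v k) (u k)]
  have hzero : ∑ k with v k = 0, |v k| = 0 :=
    Finset.sum_eq_zero fun k hk => by simp [(Finset.mem_filter.1 hk).2]
  linarith [sum_support_add_sum_compl v v, sum_support_add_sum_compl v u]

/-! ### Penalized likelihood near a sparse vector -/

variable {ρ : ℝ}

lemma penalizedLogLik_le (hx : ∀ i k, |x i k| ≤ 1) (hρ : 0 ≤ ρ)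
    (hscore : ∀ k, |logisticScore x y v k| ≤ ρ / 2) :
    penalizedLogLik x y ρ u ≤ penalizedLogLik x y ρ v - ρ / 4 * ∑ k, |(u - v) k| +
      (7 / 4 * ρ * ∑ k with v k ≠ 0, |(u - v) k| - ρ / 4 * ∑ k with v k = 0, |(u - v) k| -
        ((u - v) ⬝ᵥ (logisticInfo x v *ᵥ (u - v))) / (2 + ∑ k, |(u - v) k|)) := by
  have hlik := logisticLogLik_le (u := u) hx hscore
  have hpen := mul_le_mul_of_nonneg_left (sum_abs_sub_le u v) hρ
  have hsplit := sum_support_add_sum_compl v (u - v)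
  rw [← hsplit] at hlik ⊢
  rw [penalizedLogLik, penalizedLogLik]
  linarith

lemma le_penalizedLogLik (hx : ∀ i k, |x i k| ≤ 1) (hρ : 0 < ρ)
    (hscore : ∀ k, |logisticScore x y v k| ≤ ρ / 2) {s : ℝ} (hs : ∑ k, |(u - v) k| ≤ s / ρ) :
    penalizedLogLik x y ρ v - (3 / 2 * s + Fintype.card ι * s ^ 2 / (2 * ρ ^ 2)) ≤
      penalizedLogLik x y ρ u := by
  have hlik := le_logisticLogLik (u := u) hx hscore
  have : 0 ≤ ∑ k, |(u - v) k| := Finset.sum_nonneg fun _ _ => abs_nonneg _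
  have hpen : ∑ k, |u k| ≤ ∑ k, |v k| + ∑ k, |(u - v) k| := by
    rw [← Finset.sum_add_distrib]
    exact Finset.sum_le_sum fun k _ => by simpa using abs_add_le (v k) ((u - v) k)
  have hlinear : ρ * ∑ k, |(u - v) k| ≤ s := by rwa [mul_comm, ← le_div_iff₀ hρ]
  have hquad : Fintype.card ι * (∑ k, |(u - v) k|) ^ 2 / 2 ≤
      Fintype.card ι * s ^ 2 / (2 * ρ ^ 2) := by
    rw [mul_comm 2, ← div_div, mul_div_assoc _ (s ^ 2), ← div_pow]
    gcongr
  rw [penalizedLogLik, penalizedLogLik]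
  linarith [mul_le_mul_of_nonneg_left hpen hρ.le]

lemma sq_sum_abs_le_card_mul (s : Finset κ) (d : κ → ℝ) :
    (∑ k ∈ s, |d k|) ^ 2 ≤ s.card * ∑ k, d k ^ 2 := by
  refine sq_sum_le_card_mul_sum_sq.trans (mul_le_mul_of_nonneg_left ?_ (Nat.cast_nonneg _))
  simp only [sq_abs]
  exact Finset.sum_le_univ_sum_of_nonneg fun k => sq_nonneg _

-- The quadratic term absorbs the linear one through AM-GM when `4B ≤ 1`, and through `64ρs ≤ m`
-- otherwise.
lemma cone_exponent_le {B s q m : ℝ} (hB : 0 ≤ B) (hρ : 0 ≤ ρ) (hs : 0 ≤ s) (hq : 0 ≤ q)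
    (hBq : B ^ 2 ≤ s * q) (hm : 0 < m) (hms : 64 * ρ * s ≤ m) :
    2 * ρ * B - m * q / (4 * (1 + 4 * B)) ≤ 8 * ρ ^ 2 * s / m := by
  rcases le_total (4 * B) 1 with hB4 | hB4
  · have hquad : m * q / 8 ≤ m * q / (4 * (1 + 4 * B)) := by
      gcongr
      linarith
    have hamgm : 2 * ρ * B * m ≤ m ^ 2 * q / 8 + 8 * ρ ^ 2 * s := by
      refine abs_le_of_sq_le_sq' ?_ (by positivity) |>.2
      calc (2 * ρ * B * m) ^ 2 = 4 * ρ ^ 2 * m ^ 2 * B ^ 2 := by ring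
        _ ≤ 4 * ρ ^ 2 * m ^ 2 * (s * q) := by gcongr
        _ = 4 * (m ^ 2 * q / 8) * (8 * ρ ^ 2 * s) := by ring
        _ ≤ (m ^ 2 * q / 8 + 8 * ρ ^ 2 * s) ^ 2 := four_mul_le_sq_add _ _
    have hdiv : 2 * ρ * B ≤ m * q / 8 + 8 * ρ ^ 2 * s / m := by
      rw [← mul_le_mul_iff_left₀ hm, add_mul, div_mul_cancel₀ _ hm.ne']
      linarith
    linarith
  · have hBpos : 0 < B := by linarith
    have hquad : 2 * ρ * B ≤ m * q / (4 * (1 + 4 * B)) := by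
      rw [le_div_iff₀ (by positivity)]
      calc 2 * ρ * B * (4 * (1 + 4 * B)) ≤ 2 * ρ * B * (4 * (8 * B)) := by gcongr; linarith
        _ = 64 * ρ * B ^ 2 := by ring
        _ ≤ 64 * ρ * (s * q) := by gcongr
        _ = 64 * ρ * s * q := by ring
        _ ≤ m * q := by gcongr
    have hnonneg : 0 ≤ 8 * ρ ^ 2 * s / m := by positivity
    linarith

lemma penalizedLogLik_le_of_cone (hx : ∀ i k, |x i k| ≤ 1) (hρ : 0 ≤ ρ)
    (hscore : ∀ k, |logisticScore x y v k| ≤ ρ / 2) {m : ℝ} (hm : 0 < m)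
    (hms : 64 * ρ * (Finset.univ.filter fun k => v k ≠ 0).card ≤ m)
    (hcurv : ∀ d : κ → ℝ, ∑ k with v k = 0, |d k| ≤ 7 * ∑ k with v k ≠ 0, |d k| →
      m / 2 * ∑ k, d k ^ 2 ≤ d ⬝ᵥ (logisticInfo x v *ᵥ d)) (u : κ → ℝ) :
    penalizedLogLik x y ρ u ≤ penalizedLogLik x y ρ v - ρ / 4 * ∑ k, |(u - v) k| +
      8 * ρ ^ 2 * (Finset.univ.filter fun k => v k ≠ 0).card / m := by
  refine (penalizedLogLik_le hx hρ hscore).trans ?_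
  set B := ∑ k with v k ≠ 0, |(u - v) k|
  set C := ∑ k with v k = 0, |(u - v) k|
  set q := ∑ k, (u - v) k ^ 2
  set s : ℝ := ((Finset.univ.filter fun k => v k ≠ 0).card : ℝ)
  have hB : 0 ≤ B := Finset.sum_nonneg fun _ _ => abs_nonneg _
  have hC : 0 ≤ C := Finset.sum_nonneg fun _ _ => abs_nonneg _
  have hq : 0 ≤ q := Finset.sum_nonneg fun _ _ => sq_nonneg _
  have hBC : B + C = ∑ k, |(u - v) k| := sum_support_add_sum_compl v (u - v)
  rw [add_le_add_iff_left, ← hBC]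
  rcases le_total C (7 * B) with hcone | hcone
  · have hcurv' : m * q / (4 * (1 + 4 * B)) ≤
        ((u - v) ⬝ᵥ (logisticInfo x v *ᵥ (u - v))) / (2 + (B + C)) :=
      calc m * q / (4 * (1 + 4 * B)) = m / 2 * q / (2 + 8 * B) := by field_simp; ring
        _ ≤ m / 2 * q / (2 + (B + C)) := by
          gcongr
          linarith
        _ ≤ _ := by
          gcongr
          exact hcurv _ hcone
    have hexp := cone_exponent_le hB hρ (Nat.cast_nonneg _) hq (sq_sum_abs_le_card_mul _ _) hm hms
    linarith [mul_nonneg hρ hB, mul_nonneg hρ hC]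
  · have hinfo : 0 ≤ ((u - v) ⬝ᵥ (logisticInfo x v *ᵥ (u - v))) / (2 + (B + C)) := by
      rw [dotProduct_logisticInfo_mulVec]
      exact div_nonneg (Finset.sum_nonneg fun i _ =>
        mul_nonneg (logisticVariance_nonneg _) (sq_nonneg _)) (by positivity)
    have hnonneg : 0 ≤ 8 * ρ ^ 2 * s / m := by positivity
    linarith [mul_le_mul_of_nonneg_left hcone hρ]

lemma penalizedLogLik_le_of_sparse (hx : ∀ i k, |x i k| ≤ 1) (hρ : 0 ≤ ρ)
    (hscore : ∀ k, |logisticScore x y v k| ≤ ρ / 2) {m b : ℝ} (hm : 0 ≤ m)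
    (hsparse : (Finset.univ.filter fun k => (u - v) k ≠ 0).card ≤ b)
    (hcurv : m / 2 * ∑ k, (u - v) k ^ 2 ≤ (u - v) ⬝ᵥ (logisticInfo x v *ᵥ (u - v))) :
    penalizedLogLik x y ρ u ≤ penalizedLogLik x y ρ v - ρ / 4 * ∑ k, |(u - v) k| +
      (2 * ρ * √(b * ∑ k, (u - v) k ^ 2) -
        m * (∑ k, (u - v) k ^ 2) / (2 * (2 + √(b * ∑ k, (u - v) k ^ 2)))) := by
  refine (penalizedLogLik_le hx hρ hscore).trans ?_
  set q := ∑ k, (u - v) k ^ 2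
  set r := √(b * q)
  have hq : 0 ≤ q := Finset.sum_nonneg fun _ _ => sq_nonneg _
  have hr : 0 ≤ r := Real.sqrt_nonneg _
  have hnorm : ∑ k, |(u - v) k| ≤ r := by
    refine Real.le_sqrt_of_sq_le (le_trans ?_ (mul_le_mul_of_nonneg_right hsparse hq))
    rw [← Finset.sum_filter_of_ne fun k _ => abs_ne_zero.1]
    exact sq_sum_abs_le_card_mul _ _
  have hinfo : m * q / (2 * (2 + r)) ≤
      ((u - v) ⬝ᵥ (logisticInfo x v *ᵥ (u - v))) / (2 + ∑ k, |(u - v) k|) :=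
    calc m * q / (2 * (2 + r)) = m / 2 * q / (2 + r) := by field_simp
      _ ≤ m / 2 * q / (2 + ∑ k, |(u - v) k|) := by gcongr
      _ ≤ _ := by gcongr
  have hC : 0 ≤ ∑ k with v k = 0, |(u - v) k| := Finset.sum_nonneg fun _ _ => abs_nonneg _
  have hBr : ∑ k with v k ≠ 0, |(u - v) k| ≤ r := by
    linarith [sum_support_add_sum_compl v (u - v)]
  linarith [mul_nonneg hρ hr, mul_nonneg hρ hC, mul_le_mul_of_nonneg_left hBr hρ]

lemma sparse_exponent_le {b m T r q : ℝ} (hρ : 0 ≤ ρ) (hb : 0 < b) (hr : 0 < r)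
    (hrq : r ^ 2 = b * q) (hT : 48 ≤ T) (hTr : T * b * ρ ≤ m * r) (hmb : 64 * ρ * b ≤ m) :
    2 * ρ * r - m * q / (2 * (2 + r)) ≤ -(T / 8 * (ρ * min 1 r)) := by
  have hq_linear : T * ρ * r ≤ m * q := by
    refine le_of_mul_le_mul_left ?_ hb
    calc b * (T * ρ * r) = T * b * ρ * r := by ring
      _ ≤ m * r * r := by gcongr
      _ = b * (m * q) := by linear_combination m * hrq
  have hq_quad : 64 * ρ * r ^ 2 ≤ m * q := by
    refine le_of_mul_le_mul_left ?_ hb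
    calc b * (64 * ρ * r ^ 2) = 64 * ρ * b * r ^ 2 := by ring
      _ ≤ m * r ^ 2 := by gcongr
      _ = b * (m * q) := by linear_combination m * hrq
  have hmq : 0 ≤ m * q := le_trans (by positivity) hq_quad
  suffices h : T / 8 * (ρ * min 1 r) + 2 * ρ * r ≤ m * q / (2 * (2 + r)) by linarith
  rcases le_total r 1 with hr1 | hr1
  · rw [min_eq_right hr1]
    have hdiv : m * q / 6 ≤ m * q / (2 * (2 + r)) := by
      gcongr
      linarith
    linarith [mul_le_mul_of_nonneg_right hT (mul_nonneg hρ hr.le)]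
  · rw [min_eq_left hr1]
    have hdiv : m * q / (6 * r) ≤ m * q / (2 * (2 + r)) :=
      div_le_div_of_nonneg_left hmq (by positivity) (by linarith)
    refine le_trans ?_ hdiv
    rw [le_div_iff₀ (by positivity)]
    linarith [mul_nonneg (mul_nonneg (by linarith : 0 ≤ T) hρ) hr.le]

end LogisticRegression

/-! ### The Ising model -/

/-- The configuration `x ∈ {0,1}^p` as a real vector. -/
def spinVector {p : ℕ} (x : Fin p → Fin 2) : Fin p → ℝ := fun k => ((x k).val : ℝ)

/-- The energy of the Ising model, extended to all real vectors: `isingWeight θ x` is its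
exponential at the vector of spins. -/
noncomputable def isingEnergy {p : ℕ} (θ : Matrix (Fin p) (Fin p) ℝ) (y : Fin p → ℝ) : ℝ :=
  ∑ j, θ j j * y j + ∑ j, ∑ i with i < j, θ i j * y i * y j

lemma sum_sum_eq_diag_add_two_mul_sum_lt {ι : Type*} [Fintype ι] [LinearOrder ι] {f : ι → ι → ℝ}
    (hf : ∀ i j, f i j = f j i) :
    ∑ j, ∑ i, f i j = ∑ j, f j j + 2 * ∑ j, ∑ i with i < j, f i j := by
  have hsplit (i j : ι) : f i j =
      (if i = j then f j j else 0) +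
        ((if i < j then f i j else 0) + if j < i then f i j else 0) := by
    rcases lt_trichotomy i j with h | rfl | h
    · simp [h, h.ne, h.not_gt]
    · simp
    · simp [h, h.ne', h.not_gt]
  have hswap : ∑ j, ∑ i, (if j < i then f i j else 0) = ∑ j, ∑ i, if i < j then f i j else 0 := by
    rw [Finset.sum_comm]
    exact Finset.sum_congr rfl fun j _ => Finset.sum_congr rfl fun i _ => by rw [hf]
  simp_rw [Finset.sum_filter]
  rw [Finset.sum_congr rfl fun j _ => Finset.sum_congr rfl fun i _ => hsplit i j]
  simp only [Finset.sum_add_distrib, Finset.sum_ite_eq', Finset.mem_univ, if_true, hswap]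
  ring

section Ising

variable {p : ℕ} {θ : Matrix (Fin p) (Fin p) ℝ}

lemma two_mul_isingEnergy (hθ : θ.IsSymm) (y : Fin p → ℝ) :
    2 * isingEnergy θ y = y ⬝ᵥ (θ *ᵥ y) + ∑ j, θ j j * (2 * y j - y j ^ 2) := by
  have hquad : y ⬝ᵥ (θ *ᵥ y) = ∑ j, ∑ i, θ i j * y i * y j := by
    simp only [dotProduct, Matrix.mulVec, Finset.mul_sum]
    refine Finset.sum_congr rfl fun j _ => Finset.sum_congr rfl fun i _ => ?_
    rw [hθ.apply]
    ring
  have hsymm (i j : Fin p) : θ i j * y i * y j = θ j i * y j * y i := by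
    rw [hθ.apply]
    ring
  rw [hquad, sum_sum_eq_diag_add_two_mul_sum_lt hsymm, isingEnergy, mul_add, Finset.mul_sum,
    add_right_comm, ← Finset.sum_add_distrib]
  congr 1
  exact Finset.sum_congr rfl fun j _ => by ring

lemma isingEnergy_add_single (hθ : θ.IsSymm) {j : Fin p} {y : Fin p → ℝ} (hy : y j = 0) :
    isingEnergy θ (y + Pi.single j 1) =
      isingEnergy θ y + θ.col j ⬝ᵥ (y + Pi.single j 1) := by
  have hrow : θ.row j = θ.col j := funext fun k => hθ.apply k j
  have hquad : (y + Pi.single j 1) ⬝ᵥ (θ *ᵥ (y + Pi.single j 1)) =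
      y ⬝ᵥ (θ *ᵥ y) + 2 * (θ.col j ⬝ᵥ y) + θ j j := by
    have hcross : (θ *ᵥ y) j = θ.col j ⬝ᵥ y := by rw [← hrow]; rfl
    rw [Matrix.mulVec_add, add_dotProduct, dotProduct_add, dotProduct_add, Matrix.mulVec_single_one,
      single_one_dotProduct, single_one_dotProduct, hcross,
      dotProduct_comm y (θ.col j), Matrix.col_apply]
    ring
  have hdiag : ∑ k, θ k k * (2 * (y + Pi.single j 1 : Fin p → ℝ) k -
      (y + Pi.single j 1 : Fin p → ℝ) k ^ 2) = ∑ k, θ k k * (2 * y k - y k ^ 2) + θ j j := by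
    rw [← sub_eq_iff_eq_add', ← Finset.sum_sub_distrib, Finset.sum_eq_single j]
    · simp [hy]
      ring
    · intro k _ hk
      simp [hk]
    · simp
  have hnew := two_mul_isingEnergy hθ (y + Pi.single j 1)
  have hold := two_mul_isingEnergy hθ y
  rw [hquad, hdiag] at hnew
  rw [dotProduct_add, dotProduct_single_one, Matrix.col_apply]
  linarith

lemma withIntercept_eq_spinVector_update (j : Fin p) (x : Fin p → Fin 2) :
    withIntercept j x = spinVector (Function.update x j 1) := by
  funext k
  rcases eq_or_ne k j with rfl | hk
  · simp [withIntercept, spinVector]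
  · simp [withIntercept, spinVector, hk]

lemma spinVector_update_one (j : Fin p) (x : Fin p → Fin 2) :
    spinVector (Function.update x j 1) = spinVector (Function.update x j 0) + Pi.single j 1 := by
  funext k
  rcases eq_or_ne k j with rfl | hk
  · simp [spinVector]
  · simp [spinVector, hk]

lemma withIntercept_update (j : Fin p) (x : Fin p → Fin 2) (b : Fin 2) :
    withIntercept j (Function.update x j b) = withIntercept j x := by
  simp [withIntercept_eq_spinVector_update]

lemma abs_withIntercept_le_one (j k : Fin p) (x : Fin p → Fin 2) : |withIntercept j x k| ≤ 1 := by
  rw [withIntercept_eq_spinVector_update, spinVector, Nat.abs_cast]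
  exact_mod_cast Nat.le_of_lt_succ (Fin.is_lt _)

lemma isingWeight_update_one (hθ : θ.IsSymm) (j : Fin p) (x : Fin p → Fin 2) :
    isingWeight θ (Function.update x j 1) =
      isingWeight θ (Function.update x j 0) * Real.exp (θ.col j ⬝ᵥ withIntercept j x) := by
  have hzero : spinVector (Function.update x j 0) j = 0 := by simp [spinVector]
  have henergy := isingEnergy_add_single hθ hzero
  rw [← spinVector_update_one, ← withIntercept_eq_spinVector_update] at henergy
  rw [isingWeight, isingWeight, ← Real.exp_add]
  exact congrArg Real.exp (by rw [withIntercept_eq_spinVector_update] at henergy ⊢; exact henergy)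

lemma sum_isingWeight_pos (θ : Matrix (Fin p) (Fin p) ℝ) : 0 < ∑ y, isingWeight θ y :=
  Finset.sum_pos (fun _ _ => Real.exp_pos _) Finset.univ_nonempty

lemma isingPMF_nonneg (θ : Matrix (Fin p) (Fin p) ℝ) (x : Fin p → Fin 2) : 0 ≤ isingPMF θ x :=
  div_nonneg (Real.exp_nonneg _) (sum_isingWeight_pos θ).le

/-- The residual `x_j - P(X_j = 1 | X_k = x_k, k ≠ j)` of the `j`-th spin under the Ising model. -/
noncomputable def spinResidual (θ : Matrix (Fin p) (Fin p) ℝ) (j : Fin p) (x : Fin p → Fin 2) :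
    ℝ :=
  spinVector x j - Real.sigmoid (θ.col j ⬝ᵥ withIntercept j x)

lemma abs_spinResidual_le_one (θ : Matrix (Fin p) (Fin p) ℝ) (j : Fin p) (x : Fin p → Fin 2) :
    |spinResidual θ j x| ≤ 1 := by
  have hspin : spinVector x j ≤ 1 := Nat.cast_le_one.2 (Nat.le_of_lt_succ (x j).is_lt)
  exact abs_sub_le_of_nonneg_of_le (Nat.cast_nonneg _) hspin (Real.sigmoid_nonneg _)
    (Real.sigmoid_le_one _)

lemma isingWeight_mul_spinResidual_update_one (hθ : θ.IsSymm) (j : Fin p) (x : Fin p → Fin 2) :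
    isingWeight θ (Function.update x j 1) * spinResidual θ j (Function.update x j 1) =
      -(isingWeight θ (Function.update x j 0) * spinResidual θ j (Function.update x j 0)) := by
  have hone : spinVector (Function.update x j 1) j = 1 := by simp [spinVector]
  have hzero : spinVector (Function.update x j 0) j = 0 := by simp [spinVector]
  rw [spinResidual, spinResidual, hone, hzero, withIntercept_update, withIntercept_update,
    isingWeight_update_one hθ, sigmoid_eq_exp_div]
  field_simp
  ring

lemma isingWeight_mul_spinResidual_flip (hθ : θ.IsSymm) (j : Fin p) (x : Fin p → Fin 2) :
    isingWeight θ (Function.update x j (1 - x j)) *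
      spinResidual θ j (Function.update x j (1 - x j)) =
        -(isingWeight θ x * spinResidual θ j x) := by
  have hflip := isingWeight_mul_spinResidual_update_one hθ j x
  have hspin : x j = 0 ∨ x j = 1 := by
    generalize x j = b
    fin_cases b <;> simp
  rcases hspin with h | h
  · have hx : Function.update x j 0 = x := by rw [← h, Function.update_eq_self]
    rwa [h, sub_zero, ← congrArg (isingWeight θ) hx, ← congrArg (spinResidual θ j) hx]
  · have hx : Function.update x j 1 = x := by rw [← h, Function.update_eq_self]
    rw [hx] at hflip
    rw [h, sub_self, hflip, neg_neg]

lemma sum_isingPMF_mul_spinResidual (hθ : θ.IsSymm) (j k : Fin p) :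
    ∑ x, isingPMF θ x * (spinResidual θ j x * withIntercept j x k) = 0 := by
  set f : (Fin p → Fin 2) → ℝ := fun x => isingPMF θ x * (spinResidual θ j x * withIntercept j x k)
  have hinv : Function.Involutive fun x : Fin p → Fin 2 => Function.update x j (1 - x j) :=
    fun x => by simp
  have hflip (x : Fin p → Fin 2) : f (Function.update x j (1 - x j)) = -f x := by
    simp only [f, isingPMF, withIntercept_update]
    linear_combination (withIntercept j x k / ∑ y, isingWeight θ y) *
      isingWeight_mul_spinResidual_flip hθ j x
  have hsum : ∑ x, f (Function.update x j (1 - x j)) = ∑ x, f x := Equiv.sum_comp hinv.toPerm f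
  simp only [hflip, Finset.sum_neg_distrib] at hsum
  linarith

lemma fisher_apply (θ : Matrix (Fin p) (Fin p) ℝ) (j k l : Fin p) :
    fisher θ j k l = ∑ x, isingPMF θ x * (logisticVariance (θ.col j ⬝ᵥ withIntercept j x) *
      (withIntercept j x k * withIntercept j x l)) := by
  rw [fisher, Matrix.sum_apply]
  refine Finset.sum_congr rfl fun x _ => ?_
  rw [Matrix.smul_apply, Matrix.vecMulVec_apply, iteratedDeriv_two_logPartition, smul_eq_mul,
    mul_assoc]
  rfl

end Ising

/-! ### Concentration of the score and of the observed information -/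

section Concentration

variable {Ω ι : Type*} [MeasurableSpace Ω] {P : Measure Ω} [Fintype ι]

lemma measure_iUnion_le_card_mul {A : ι → Set Ω} {b : ℝ≥0∞} (hA : ∀ i, P (A i) ≤ b) :
    P (⋃ i, A i) ≤ Fintype.card ι * b :=
  (measure_iUnion_fintype_le P A).trans <| (Finset.sum_le_card_nsmul _ _ b fun i _ => hA i).trans_eq
    (nsmul_eq_mul _ _)

variable [IsProbabilityMeasure P] {Y : ι → Ω → ℝ}

lemma measureReal_le_sum_sub_integral_le (hmeas : ∀ i, Measurable (Y i)) (hindep : iIndepFun Y P)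
    (hY : ∀ i ω, |Y i ω| ≤ 1) {t : ℝ} (ht : 0 ≤ t) :
    P.real {ω | t ≤ ∑ i, (Y i ω - ∫ ω', Y i ω' ∂P)} ≤
      Real.exp (-t ^ 2 / (2 * Fintype.card ι)) := by
  have hsub (i : ι) : HasSubgaussianMGF (fun ω => Y i ω - ∫ ω', Y i ω' ∂P) 1 P := by
    convert hasSubgaussianMGF_of_mem_Icc (a := -1) (b := 1) (hmeas i).aemeasurable
      (Filter.Eventually.of_forall fun ω => abs_le.1 (hY i ω)) using 1
    · ext
      norm_num
    · infer_instance
  have hcentered : iIndepFun (fun i ω => Y i ω - ∫ ω', Y i ω' ∂P) P :=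
    hindep.comp (fun i y => y - ∫ ω', Y i ω' ∂P) fun _ => by fun_prop
  simpa using HasSubgaussianMGF.measure_sum_ge_le_of_iIndepFun hcentered (s := Finset.univ)
    (fun i _ => hsub i) ht

lemma measure_lt_abs_sum_sub_integral_le (hmeas : ∀ i, Measurable (Y i)) (hindep : iIndepFun Y P)
    (hY : ∀ i ω, |Y i ω| ≤ 1) {t : ℝ} (ht : 0 ≤ t) :
    P {ω | t < |∑ i, (Y i ω - ∫ ω', Y i ω' ∂P)|} ≤
      ENNReal.ofReal (2 * Real.exp (-t ^ 2 / (2 * Fintype.card ι))) := by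
  have hupper := measureReal_le_sum_sub_integral_le hmeas hindep hY ht
  have hlower := measureReal_le_sum_sub_integral_le (Y := fun i ω => -Y i ω)
    (fun i => (hmeas i).neg) (hindep.comp (fun _ y => -y) fun _ => measurable_neg)
    (fun i ω => by rw [abs_neg]; exact hY i ω) ht
  have hcover : {ω | t < |∑ i, (Y i ω - ∫ ω', Y i ω' ∂P)|} ⊆
      {ω | t ≤ ∑ i, (Y i ω - ∫ ω', Y i ω' ∂P)} ∪
        {ω | t ≤ ∑ i, (-Y i ω - ∫ ω', -Y i ω' ∂P)} := by
    intro ω hω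
    simp only [integral_neg, ← neg_sub', Finset.sum_neg_distrib, Set.mem_union, Set.mem_ofPred_eq]
    exact (lt_abs.1 hω).imp le_of_lt le_of_lt
  rw [← ofReal_measureReal]
  refine ENNReal.ofReal_le_ofReal ((measureReal_mono hcover).trans ?_)
  linarith [measureReal_union_le (μ := P) {ω | t ≤ ∑ i, (Y i ω - ∫ ω', Y i ω' ∂P)}
    {ω | t ≤ ∑ i, (-Y i ω - ∫ ω', -Y i ω' ∂P)}]

end Concentration

/-- The design matrix of the logistic regression of the `j`-th spin on the others, with the
intercept in position `j`. -/
noncomputable def covariates {n p : ℕ} (z : Fin n → Fin p → Fin 2) (j : Fin p) :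
    Fin n → Fin p → ℝ :=
  fun i => withIntercept j (z i)

/-- The responses of the logistic regression of the `j`-th spin on the others. -/
def response {n p : ℕ} (z : Fin n → Fin p → Fin 2) (j : Fin p) : Fin n → ℝ :=
  fun i => spinVector (z i) j

/-- The event on which the contraction argument is deterministic: in every column-wise logistic
regression, the score at `θ` has entries bounded by `R`, and the entries of the observed information
are within `r` of their expectations. -/
structure RegularData {n p : ℕ} (θ : Matrix (Fin p) (Fin p) ℝ) (R r : ℝ)
    (z : Fin n → Fin p → Fin 2) : Prop where
  abs_score_le : ∀ j k, |logisticScore (covariates z j) (response z j) (θ.col j) k| ≤ R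
  abs_info_sub_le :
    ∀ j k l, |logisticInfo (covariates z j) (θ.col j) k l - n * fisher θ j k l| ≤ r

section Sample

variable {n p : ℕ} {θ : Matrix (Fin p) (Fin p) ℝ}

lemma logisticScore_eq_sum_spinResidual (z : Fin n → Fin p → Fin 2) (j k : Fin p) :
    logisticScore (covariates z j) (response z j) (θ.col j) k =
      ∑ i, spinResidual θ j (z i) * withIntercept j (z i) k := by
  rw [logisticScore, Finset.sum_apply]
  rfl

lemma logisticInfo_covariates_apply (z : Fin n → Fin p → Fin 2) (j k l : Fin p) :
    logisticInfo (covariates z j) (θ.col j) k l =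
      ∑ i, logisticVariance (θ.col j ⬝ᵥ withIntercept j (z i)) *
        (withIntercept j (z i) k * withIntercept j (z i) l) := by
  rw [logisticInfo, Matrix.sum_apply]
  rfl

variable {Ω : Type*} [MeasurableSpace Ω] {P : Measure Ω} [IsProbabilityMeasure P]
  {X : Fin n → Ω → Fin p → Fin 2}

lemma IsIsingSample.integral_comp (hX : IsIsingSample P θ X) (i : Fin n)
    (F : (Fin p → Fin 2) → ℝ) : ∫ ω, F (X i ω) ∂P = ∑ x, isingPMF θ x * F x := by
  have hm := hX.measurable i
  have : IsProbabilityMeasure (P.map (X i)) := Measure.isProbabilityMeasure_map hm.aemeasurable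
  rw [← integral_map hm.aemeasurable (by fun_prop), integral_fintype Integrable.of_finite]
  refine Finset.sum_congr rfl fun x _ => ?_
  rw [smul_eq_mul, map_measureReal_apply hm (measurableSet_singleton x), Measure.real, hX.law,
    ENNReal.toReal_ofReal (isingPMF_nonneg θ x)]

lemma IsIsingSample.measure_lt_abs_sum_le (hX : IsIsingSample P θ X) {F : (Fin p → Fin 2) → ℝ}
    (hF : ∀ x, |F x| ≤ 1) {t : ℝ} (ht : 0 ≤ t) :
    P {ω | t < |∑ i, F (X i ω) - n * ∑ x, isingPMF θ x * F x|} ≤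
      ENNReal.ofReal (2 * Real.exp (-t ^ 2 / (2 * n))) := by
  have htail := measure_lt_abs_sum_sub_integral_le (Y := fun i ω => F (X i ω))
    (fun i => (measurable_of_finite F).comp (hX.measurable i))
    (hX.indep.comp (fun _ => F) fun _ => measurable_of_finite F) (fun i ω => hF (X i ω)) ht
  simpa [hX.integral_comp, Finset.sum_sub_distrib] using htail

lemma IsIsingSample.measure_lt_abs_score_le (hX : IsIsingSample P θ X) (hθ : θ.IsSymm)
    (j k : Fin p) {R : ℝ} (hR : 0 ≤ R) :
    P {ω | R < |logisticScore (covariates (fun i => X i ω) j) (response (fun i => X i ω) j)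
        (θ.col j) k|} ≤ ENNReal.ofReal (2 * Real.exp (-R ^ 2 / (2 * n))) := by
  have htail := hX.measure_lt_abs_sum_le
    (F := fun x => spinResidual θ j x * withIntercept j x k) (fun x => by
      rw [abs_mul]
      exact mul_le_one₀ (abs_spinResidual_le_one θ j x) (abs_nonneg _)
        (abs_withIntercept_le_one j k x)) hR
  simpa only [sum_isingPMF_mul_spinResidual hθ, mul_zero, sub_zero,
    logisticScore_eq_sum_spinResidual] using htail

lemma IsIsingSample.measure_lt_abs_info_sub_le (hX : IsIsingSample P θ X) (j k l : Fin p) {r : ℝ}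
    (hr : 0 ≤ r) :
    P {ω | r < |logisticInfo (covariates (fun i => X i ω) j) (θ.col j) k l -
        n * fisher θ j k l|} ≤ ENNReal.ofReal (2 * Real.exp (-r ^ 2 / (2 * n))) := by
  have htail := hX.measure_lt_abs_sum_le
    (F := fun x => logisticVariance (θ.col j ⬝ᵥ withIntercept j x) *
      (withIntercept j x k * withIntercept j x l)) (fun x => by
      rw [abs_mul, abs_mul, abs_of_nonneg (logisticVariance_nonneg _)]
      exact mul_le_one₀ (logisticVariance_le_one _) (by positivity)
        (mul_le_one₀ (abs_withIntercept_le_one j k x) (abs_nonneg _)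
          (abs_withIntercept_le_one j l x))) hr
  simpa only [← fisher_apply, ← logisticInfo_covariates_apply] using htail

lemma IsIsingSample.measure_not_regularData_le (hX : IsIsingSample P θ X) (hθ : θ.IsSymm)
    {R r η : ℝ} (hR : 0 ≤ R) (hr : 0 ≤ r) (hRη : Real.exp (-R ^ 2 / (2 * n)) ≤ η)
    (hrη : Real.exp (-r ^ 2 / (2 * n)) ≤ η) :
    P {ω | ¬ RegularData θ R r fun i => X i ω} ≤ (p ^ 2 + p ^ 3) * ENNReal.ofReal (2 * η) := by
  have hscore := measure_iUnion_le_card_mul fun jk : Fin p × Fin p =>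
    (hX.measure_lt_abs_score_le hθ jk.1 jk.2 hR).trans
      (ENNReal.ofReal_le_ofReal (mul_le_mul_of_nonneg_left hRη zero_le_two))
  have hinfo := measure_iUnion_le_card_mul fun jkl : Fin p × Fin p × Fin p =>
    (hX.measure_lt_abs_info_sub_le jkl.1 jkl.2.1 jkl.2.2 hr).trans
      (ENNReal.ofReal_le_ofReal (mul_le_mul_of_nonneg_left hrη zero_le_two))
  refine (measure_mono fun ω hω => ?_).trans
    ((measure_union_le _ _).trans ((add_le_add hscore hinfo).trans_eq ?_))
  · by_contra hnot
    simp only [Set.mem_union, Set.mem_iUnion, Set.mem_ofPred_eq, not_or, not_exists, not_lt,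
      Prod.forall] at hnot
    exact hω ⟨hnot.1, hnot.2⟩
  · simp only [Fintype.card_prod, Fintype.card_fin, Nat.cast_mul]
    ring

end Sample

/-! ### Curvature of the column-wise log-likelihoods -/

lemma abs_dotProduct_mulVec_sub_le {ι : Type*} [Fintype ι] {A B : Matrix ι ι ℝ} {r : ℝ}
    (h : ∀ k l, |A k l - B k l| ≤ r) (d : ι → ℝ) :
    |d ⬝ᵥ (A *ᵥ d) - d ⬝ᵥ (B *ᵥ d)| ≤ r * (∑ k, |d k|) ^ 2 := by
  have hrow (k : ι) : |((A - B) *ᵥ d) k| ≤ r * ∑ l, |d l| := abs_dotProduct_le (h k)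
  rw [← dotProduct_sub, ← Matrix.sub_mulVec, dotProduct_comm, sq, ← mul_assoc]
  exact abs_dotProduct_le hrow

section Curvature

variable {n p : ℕ} {θ : Matrix (Fin p) (Fin p) ℝ} {j : Fin p} {d : Fin p → ℝ}

lemma sum_isingPMF (θ : Matrix (Fin p) (Fin p) ℝ) : ∑ x, isingPMF θ x = 1 := by
  simp only [isingPMF]
  rw [← Finset.sum_div, div_self (sum_isingWeight_pos θ).ne']

lemma fisher_self_le_one (θ : Matrix (Fin p) (Fin p) ℝ) (j k : Fin p) : fisher θ j k k ≤ 1 := by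
  rw [fisher_apply]
  refine (Finset.sum_le_sum fun x _ => ?_).trans_eq (sum_isingPMF θ)
  have hcov := abs_withIntercept_le_one j k x
  refine mul_le_of_le_one_right (isingPMF_nonneg θ x) ?_
  rw [← abs_mul_abs_self]
  exact mul_le_one₀ (logisticVariance_le_one _) (by positivity)
    (mul_le_one₀ hcov (abs_nonneg _) hcov)

lemma kappaSparse_le_rayleigh {s : ℕ} (hd : d ≠ 0) (hs : l0 d ≤ s) :
    kappaSparse θ s ≤ rayleigh θ j d :=
  iInf_le_of_le j (iInf_le_of_le d (iInf_le_of_le ⟨hd, hs⟩ le_rfl))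

lemma kappaCone_le_rayleigh (hd : d ≠ 0)
    (hcone : ∑ k with θ k j = 0, |d k| ≤ 7 * ∑ k with θ k j ≠ 0, |d k|) :
    kappaCone θ ≤ rayleigh θ j d :=
  iInf_le_of_le j (iInf_le_of_le d (iInf_le_of_le ⟨hd, hcone⟩ le_rfl))

lemma rayleigh_single_le_one (θ : Matrix (Fin p) (Fin p) ℝ) (j k : Fin p) :
    rayleigh θ j (Pi.single k 1) ≤ 1 := by
  have hnorm : ∑ l, (Pi.single k 1 : Fin p → ℝ) l ^ 2 = 1 := by
    simp [Pi.single_apply]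
  rw [rayleigh, hnorm, div_one, ENNReal.ofReal_le_one]
  simpa using fisher_self_le_one θ j k

lemma kappaSparse_le_one {s : ℕ} (hs : 1 ≤ s) (j : Fin p) : kappaSparse θ s ≤ 1 := by
  refine (kappaSparse_le_rayleigh (j := j) (d := Pi.single j 1) (by simp) ?_).trans
    (rayleigh_single_le_one θ j j)
  simpa [l0, Pi.single_apply, Finset.filter_eq'] using hs

lemma kappaCone_le_one_of_ne_zero {k : Fin p} (hk : θ k j ≠ 0) : kappaCone θ ≤ 1 := by
  refine (kappaCone_le_rayleigh (j := j) (d := Pi.single k 1) (by simp) ?_).trans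
    (rayleigh_single_le_one θ j k)
  rw [Finset.sum_eq_zero fun l hl => ?_]
  · positivity
  · have hlk : l ≠ k := fun h => hk (h ▸ (Finset.mem_filter.1 hl).2)
    simp [hlk]

-- `kappaCone θ` is infinite only if all columns vanish, and then `4608 / kappaCone θ` is `0`.
lemma exists_le_kappaCone {κ : ℝ} (h : ENNReal.ofReal κ ≤ kappaCone θ) (j : Fin p)
    (c : ℝ≥0∞) :
    ∃ K, κ ≤ K ∧ ENNReal.ofReal K ≤ kappaCone θ ∧
      c.toReal / K * colSparsity θ j = (c / kappaCone θ).toReal * colSparsity θ j := by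
  rcases eq_or_ne (kappaCone θ) ⊤ with htop | htop
  · have hzero : colSparsity θ j = 0 := by
      rw [colSparsity, l0, Finset.card_eq_zero, Finset.filter_eq_empty_iff]
      exact fun k _ hk => absurd (kappaCone_le_one_of_ne_zero hk) (by simp [htop])
    exact ⟨κ, le_rfl, h, by simp [hzero]⟩
  · exact ⟨(kappaCone θ).toReal, (ENNReal.ofReal_le_iff_le_toReal htop).1 h,
      ENNReal.ofReal_toReal_le,
      by rw [ENNReal.toReal_div]⟩

lemma mul_sum_sq_le_dotProduct_fisher_mulVec {K : ℝ} (hK : 0 < K)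
    (h : d ≠ 0 → ENNReal.ofReal K ≤ rayleigh θ j d) :
    K * ∑ k, d k ^ 2 ≤ d ⬝ᵥ (fisher θ j *ᵥ d) := by
  rcases eq_or_ne d 0 with rfl | hd
  · simp
  · have hnorm : 0 < ∑ k, d k ^ 2 := by
      obtain ⟨k, hk⟩ := Function.ne_iff.1 hd
      exact Finset.sum_pos' (fun _ _ => sq_nonneg _) ⟨k, Finset.mem_univ k, sq_pos_of_ne_zero hk⟩
    have hpos := ENNReal.ofReal_pos.1 ((ENNReal.ofReal_pos.2 hK).trans_le (h hd))
    exact (le_div_iff₀ hnorm).1 ((ENNReal.ofReal_le_ofReal_iff hpos.le).1 (h hd))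

lemma sq_sum_abs_le_of_cone
    (hcone : ∑ k with θ k j = 0, |d k| ≤ 7 * ∑ k with θ k j ≠ 0, |d k|) :
    (∑ k, |d k|) ^ 2 ≤ 64 * colSparsity θ j * ∑ k, d k ^ 2 := by
  have hsplit : ∑ k with θ k j ≠ 0, |d k| + ∑ k with θ k j = 0, |d k| = ∑ k, |d k| :=
    sum_support_add_sum_compl (θ.col j) d
  calc (∑ k, |d k|) ^ 2 ≤ (8 * ∑ k with θ k j ≠ 0, |d k|) ^ 2 := by
        have hle : ∑ k, |d k| ≤ 8 * ∑ k with θ k j ≠ 0, |d k| := by linarith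
        gcongr
    _ = 64 * (∑ k with θ k j ≠ 0, |d k|) ^ 2 := by ring
    _ ≤ 64 * colSparsity θ j * ∑ k, d k ^ 2 := by
        rw [mul_assoc]
        gcongr
        exact sq_sum_abs_le_card_mul _ d

namespace RegularData

variable {R r K : ℝ} {z : Fin n → Fin p → Fin 2}

lemma half_mul_sum_sq_le (hz : RegularData θ R r z) (hr : 0 ≤ r)
    (hK : K * ∑ k, d k ^ 2 ≤ d ⬝ᵥ (fisher θ j *ᵥ d)) {a : ℝ}
    (ha : (∑ k, |d k|) ^ 2 ≤ a * ∑ k, d k ^ 2) (hra : 2 * (r * a) ≤ n * K) :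
    n * K / 2 * ∑ k, d k ^ 2 ≤ d ⬝ᵥ (logisticInfo (covariates z j) (θ.col j) *ᵥ d) := by
  have hdev := (abs_le.1 (abs_dotProduct_mulVec_sub_le (B := (n : ℝ) • fisher θ j)
    (hz.abs_info_sub_le j) d)).1
  rw [Matrix.smul_mulVec, dotProduct_smul, smul_eq_mul] at hdev
  have hcurv := mul_le_mul_of_nonneg_left hK n.cast_nonneg
  have herr : r * (∑ k, |d k|) ^ 2 ≤ n * K / 2 * ∑ k, d k ^ 2 := by
    calc r * (∑ k, |d k|) ^ 2 ≤ r * (a * ∑ k, d k ^ 2) := by gcongr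
      _ = 2 * (r * a) / 2 * ∑ k, d k ^ 2 := by ring
      _ ≤ n * K / 2 * ∑ k, d k ^ 2 := by gcongr
  linarith

lemma half_mul_sum_sq_le_of_cone (hz : RegularData θ R r z) (hr : 0 ≤ r) (hK : 0 < K)
    (hKcone : ENNReal.ofReal K ≤ kappaCone θ) (hrs : 128 * (r * colSparsity θ j) ≤ n * K)
    (hcone : ∑ k with θ k j = 0, |d k| ≤ 7 * ∑ k with θ k j ≠ 0, |d k|) :
    n * K / 2 * ∑ k, d k ^ 2 ≤ d ⬝ᵥ (logisticInfo (covariates z j) (θ.col j) *ᵥ d) :=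
  hz.half_mul_sum_sq_le hr
    (mul_sum_sq_le_dotProduct_fisher_mulVec hK fun hd =>
      hKcone.trans (kappaCone_le_rayleigh hd hcone))
    (sq_sum_abs_le_of_cone hcone) (by linarith)

lemma half_mul_sum_sq_le_of_sparse (hz : RegularData θ R r z) (hr : 0 ≤ r) (hK : 0 < K) {s : ℕ}
    (hKsparse : ENNReal.ofReal K ≤ kappaSparse θ s) (hd : l0 d ≤ s) (hrs : 2 * (r * l0 d) ≤ n * K) :
    n * K / 2 * ∑ k, d k ^ 2 ≤ d ⬝ᵥ (logisticInfo (covariates z j) (θ.col j) *ᵥ d) := by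
  have hsum := sq_sum_abs_le_card_mul (Finset.univ.filter fun k => d k ≠ 0) d
  rw [Finset.sum_filter_of_ne fun k _ hk => by simpa using hk] at hsum
  exact hz.half_mul_sum_sq_le hr
    (mul_sum_sq_le_dotProduct_fisher_mulVec hK fun hd0 =>
      hKsparse.trans (kappaSparse_le_rayleigh hd0 hd)) hsum hrs

end RegularData

end Curvature

/-! ### The spike-and-slab prior of a column -/

lemma lintegral_fin_prod_eq_prod {n : ℕ} {E : Type*} [MeasurableSpace E] (μ : Fin n → Measure E)
    [∀ i, SigmaFinite (μ i)] {f : Fin n → E → ℝ≥0∞}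
    (hf : ∀ i, Measurable (f i)) :
    ∫⁻ x, ∏ i, f i (x i) ∂(Measure.pi μ) = ∏ i, ∫⁻ x, f i x ∂(μ i) := by
  induction n with
  | zero => simp
  | succ n ih =>
    rw [← ((measurePreserving_piFinSuccAbove μ 0).symm).lintegral_comp_emb
      (MeasurableEquiv.measurableEmbedding _)]
    simp_rw [MeasurableEquiv.piFinSuccAbove_symm_apply, Fin.insertNthEquiv,
      Fin.prod_univ_succ, Fin.insertNth_zero]
    simp only [Equiv.coe_fn_mk, Fin.cons_zero, Fin.cons_succ, Fin.zero_succAbove, cast_eq]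
    rw [lintegral_prod_mul (f := f 0) (g := fun y : Fin n → E => ∏ i : Fin n, f i.succ (y i))
      (hf 0).aemeasurable
      (Finset.measurable_prod _ fun i _ => (hf _).comp (measurable_pi_apply i)).aemeasurable,
      ih _ fun i => hf i.succ]

lemma lintegral_exp_neg_mul_abs_sub {c : ℝ} (hc : 0 < c) (a : ℝ) :
    ∫⁻ x : ℝ, ENNReal.ofReal (Real.exp (-(c * |x - a|))) = ENNReal.ofReal (2 / c) := by
  rw [lintegral_sub_right_eq_self (fun x : ℝ => ENNReal.ofReal (Real.exp (-(c * |x|)))) a]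
  have hint : ∫ x : ℝ, Real.exp (-(c * |x|)) = 2 / c := by
    have hright := integral_exp_mul_Ioi (neg_lt_zero.2 hc) 0
    simp only [neg_mul] at hright
    rw [integral_comp_abs (f := fun x => Real.exp (-(c * x))), hright]
    simp [div_eq_mul_inv]
  rw [← hint, ofReal_integral_eq_lintegral_ofReal]
  · exact .of_integral_ne_zero (by rw [hint]; positivity)
  · exact .of_forall fun x => (Real.exp_pos _).le

section ColumnPrior

variable {p : ℕ} {ρ : ℝ} {ℓ : (Fin p → ℝ) → ℝ} {v : Fin p → ℝ} {π : Finset (Fin p) → ℝ}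

instance sigmaFinite_slabFactor (δ : Finset (Fin p)) (k : Fin p) :
    SigmaFinite (if k ∈ δ then (volume : Measure ℝ) else Measure.dirac 0) := by
  split_ifs <;> infer_instance

lemma lintegral_slabMeasure_exp_le {c : ℝ} (hc : 0 < c) (δ : Finset (Fin p)) (v : Fin p → ℝ) :
    ∫⁻ u, ENNReal.ofReal (Real.exp (-(c * ∑ k, |(u - v) k|))) ∂slabMeasure δ ≤
      ENNReal.ofReal ((2 / c) ^ δ.card) := by
  have hprod (u : Fin p → ℝ) : ENNReal.ofReal (Real.exp (-(c * ∑ k, |(u - v) k|))) =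
      ∏ k, ENNReal.ofReal (Real.exp (-(c * |u k - v k|))) := by
    rw [Finset.mul_sum, ← Finset.sum_neg_distrib, Real.exp_sum,
      ENNReal.ofReal_prod_of_nonneg fun _ _ => (Real.exp_pos _).le]
    rfl
  have hpow : ENNReal.ofReal ((2 / c) ^ δ.card) =
      ∏ k, if k ∈ δ then ENNReal.ofReal (2 / c) else 1 := by
    simp [ENNReal.ofReal_pow (div_pos two_pos hc).le]
  simp_rw [hprod]
  rw [slabMeasure, lintegral_fin_prod_eq_prod _
    (f := fun k x => ENNReal.ofReal (Real.exp (-(c * |x - v k|)))) fun k => by fun_prop, hpow]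
  refine Finset.prod_le_prod' fun k _ => ?_
  split_ifs
  · exact (lintegral_exp_neg_mul_abs_sub hc _).le
  · rw [lintegral_dirac' _ (by fun_prop), ENNReal.ofReal_le_one, Real.exp_le_one_iff, neg_nonpos]
    positivity

lemma ae_slabMeasure_eq_zero (δ : Finset (Fin p)) :
    ∀ᵐ u ∂slabMeasure δ, ∀ k, k ∉ δ → u k = 0 := by
  refine ae_all_iff.2 fun k => ?_
  by_cases hk : k ∈ δ
  · simp [hk]
  · have hdirac : ∀ᵐ x ∂(if k ∈ δ then (volume : Measure ℝ) else Measure.dirac 0), x = 0 := by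
      simp [hk, ae_dirac_eq]
    filter_upwards [(Measure.quasiMeasurePreserving_eval _ k).ae hdirac] with u hu _
    exact hu

lemma l0_le_card {δ : Finset (Fin p)} {u : Fin p → ℝ} (h : ∀ k, k ∉ δ → u k = 0) :
    l0 u ≤ δ.card :=
  Finset.card_le_card fun k hk => not_imp_comm.1 (h k) (Finset.mem_filter.1 hk).2

lemma slabMeasure_lt_l0 {δ : Finset (Fin p)} {a : ℝ} (h : (δ.card : ℝ) ≤ a) :
    slabMeasure δ {u | a < l0 u} = 0 := by
  rw [measure_eq_zero_iff_ae_notMem]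
  filter_upwards [ae_slabMeasure_eq_zero δ] with u hu hlt
  exact (h.trans_lt hlt).not_ge (by exact_mod_cast l0_le_card hu)

lemma setLIntegral_columnPrior_exp (π : Finset (Fin p) → ℝ) (hρ : 0 ≤ ρ) (hℓ : Measurable ℓ)
    {B : Set (Fin p → ℝ)} (hB : MeasurableSet B) :
    ∫⁻ u in B, ENNReal.ofReal (Real.exp (ℓ u)) ∂columnPrior π ρ =
      ∑ δ, ENNReal.ofReal (π δ * (ρ / 2) ^ δ.card) *
        ∫⁻ u in B, ENNReal.ofReal (Real.exp (ℓ u - ρ * ∑ k, |u k|)) ∂slabMeasure δ := by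
  rw [columnPrior, ← Measure.sum_fintype, Measure.restrict_sum_of_countable,
    lintegral_sum_measure, tsum_fintype]
  refine Finset.sum_congr rfl fun δ _ => ?_
  have hpow : 0 ≤ (ρ / 2) ^ δ.card := by positivity
  rw [Measure.restrict_smul, lintegral_smul_measure, smul_eq_mul,
    ENNReal.ofReal_mul' hpow, mul_assoc,
    setLIntegral_withDensity_eq_setLIntegral_mul _ (by fun_prop) (by fun_prop) hB,
    ← lintegral_const_mul (ENNReal.ofReal ((ρ / 2) ^ δ.card)) (by fun_prop)]
  congr 1
  refine lintegral_congr fun u => ?_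
  rw [Pi.mul_apply, ← ENNReal.ofReal_mul (by positivity), ← ENNReal.ofReal_mul hpow, mul_assoc,
    ← Real.exp_add, neg_mul, neg_add_eq_sub]

lemma setLIntegral_columnPrior_exp_le (hπ : ∀ δ, 0 ≤ π δ) (hρ : 0 < ρ) (hℓ : Measurable ℓ)
    {B : Set (Fin p → ℝ)} (hB : MeasurableSet B) {K : ℝ}
    (h : ∀ u ∈ B, ℓ u - ρ * ∑ k, |u k| ≤ K - ρ / 4 * ∑ k, |(u - v) k|)
    {A : Finset (Finset (Fin p))} (hA : ∀ δ, δ ∉ A → slabMeasure δ B = 0) :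
    ∫⁻ u in B, ENNReal.ofReal (Real.exp (ℓ u)) ∂columnPrior π ρ ≤
      ENNReal.ofReal (Real.exp K * ∑ δ ∈ A, π δ * 4 ^ δ.card) := by
  have hslab (δ : Finset (Fin p)) :
      ∫⁻ u in B, ENNReal.ofReal (Real.exp (ℓ u - ρ * ∑ k, |u k|)) ∂slabMeasure δ ≤
        ENNReal.ofReal (Real.exp K * (2 / (ρ / 4)) ^ δ.card) := by
    calc ∫⁻ u in B, ENNReal.ofReal (Real.exp (ℓ u - ρ * ∑ k, |u k|)) ∂slabMeasure δ
        ≤ ∫⁻ u in B, ENNReal.ofReal (Real.exp K) *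
            ENNReal.ofReal (Real.exp (-(ρ / 4 * ∑ k, |(u - v) k|))) ∂slabMeasure δ := by
          refine setLIntegral_mono' hB fun u hu => ?_
          rw [← ENNReal.ofReal_mul (Real.exp_pos K).le, ← Real.exp_add, ← sub_eq_add_neg]
          exact ENNReal.ofReal_le_ofReal (Real.exp_le_exp.2 (h u hu))
      _ ≤ ENNReal.ofReal (Real.exp K) * ENNReal.ofReal ((2 / (ρ / 4)) ^ δ.card) := by
          refine (setLIntegral_le_lintegral _ _).trans ?_
          rw [lintegral_const_mul _ (by fun_prop)]
          gcongr
          exact lintegral_slabMeasure_exp_le (by positivity) δ v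
      _ = _ := (ENNReal.ofReal_mul (Real.exp_pos K).le).symm
  rw [setLIntegral_columnPrior_exp π hρ.le hℓ hB,
    ← Finset.sum_subset (Finset.subset_univ A) fun δ _ hδ => by
      rw [setLIntegral_measure_zero _ _ (hA δ hδ), mul_zero],
    Finset.mul_sum, ENNReal.ofReal_sum_of_nonneg fun δ _ => by have := hπ δ; positivity]
  refine Finset.sum_le_sum fun δ _ => (mul_le_mul_right (hslab δ) _).trans_eq ?_
  have hbase : (ρ / 2) ^ δ.card * (2 / (ρ / 4)) ^ δ.card = 4 ^ δ.card := by
    rw [← mul_pow]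
    congr 1
    field_simp
  rw [← ENNReal.ofReal_mul (by have := hπ δ; positivity), ← hbase]
  ring_nf

/-- The box of the vectors supported in `S` whose coordinates in `S` are within `r` of those of
`v`; a ball of the slab measure of `S`. -/
def sparseBox (S : Finset (Fin p)) (v : Fin p → ℝ) (r : ℝ) : Set (Fin p → ℝ) :=
  Set.univ.pi fun k => if k ∈ S then Metric.closedBall (v k) r else {0}

lemma measurableSet_sparseBox (S : Finset (Fin p)) (v : Fin p → ℝ) (r : ℝ) :
    MeasurableSet (sparseBox S v r) := by
  refine .univ_pi fun k => ?_
  split_ifs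
  exacts [measurableSet_closedBall, measurableSet_singleton 0]

lemma slabMeasure_sparseBox {r : ℝ} (hr : 0 ≤ r) (S : Finset (Fin p)) (v : Fin p → ℝ) :
    slabMeasure S (sparseBox S v r) = ENNReal.ofReal ((2 * r) ^ S.card) := by
  have hpow : ENNReal.ofReal ((2 * r) ^ S.card) =
      ∏ k, if k ∈ S then ENNReal.ofReal (2 * r) else 1 := by
    simp [ENNReal.ofReal_pow (mul_nonneg zero_le_two hr)]
  rw [slabMeasure, sparseBox, Measure.pi_pi, hpow]
  refine Finset.prod_congr rfl fun k _ => ?_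
  split_ifs <;> simp [Real.volume_closedBall]

lemma sum_abs_sub_le_of_mem_sparseBox {S : Finset (Fin p)} {r : ℝ} {u : Fin p → ℝ}
    (hv : ∀ k ∉ S, v k = 0) (hu : u ∈ sparseBox S v r) : ∑ k, |(u - v) k| ≤ S.card * r := by
  have hmem (k : Fin p) := hu k (Set.mem_univ k)
  rw [← nsmul_eq_mul, ← Finset.sum_const, ← Finset.sum_subset S.subset_univ fun k _ hk => by
    simpa [hk, hv k hk] using hmem k]
  exact Finset.sum_le_sum fun k hk => by simpa [hk, Real.dist_eq] using hmem k

lemma le_lintegral_columnPrior_exp (hρ : 0 < ρ) (hℓ : Measurable ℓ) {c : ℝ}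
    {S : Finset (Fin p)} (h : ∀ u ∈ sparseBox S v (1 / ρ), c ≤ ℓ u - ρ * ∑ k, |u k|) :
    ENNReal.ofReal (π S * Real.exp c) ≤
      ∫⁻ u, ENNReal.ofReal (Real.exp (ℓ u)) ∂columnPrior π ρ := by
  have hbox : ENNReal.ofReal (Real.exp c) * ENNReal.ofReal ((2 * (1 / ρ)) ^ S.card) ≤
      ∫⁻ u, ENNReal.ofReal (Real.exp (ℓ u - ρ * ∑ k, |u k|)) ∂slabMeasure S := by
    rw [← slabMeasure_sparseBox (by positivity) S v, ← setLIntegral_const]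
    exact (setLIntegral_mono' (measurableSet_sparseBox S v _) fun u hu =>
      ENNReal.ofReal_le_ofReal (Real.exp_le_exp.2 (h u hu))).trans (setLIntegral_le_lintegral _ _)
  have hbase : (ρ / 2) ^ S.card * (2 * (1 / ρ)) ^ S.card = 1 := by
    rw [← mul_pow]
    field_simp
    simp
  have hsum := setLIntegral_columnPrior_exp π hρ.le hℓ MeasurableSet.univ
  simp only [setLIntegral_univ] at hsum
  calc ENNReal.ofReal (π S * Real.exp c)
      = ENNReal.ofReal (π S * (ρ / 2) ^ S.card) *
          (ENNReal.ofReal (Real.exp c) * ENNReal.ofReal ((2 * (1 / ρ)) ^ S.card)) := by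
        rw [← ENNReal.ofReal_mul (by positivity), ← ENNReal.ofReal_mul' (by positivity)]
        congr 1
        linear_combination -(π S * Real.exp c) * hbase
    _ ≤ ENNReal.ofReal (π S * (ρ / 2) ^ S.card) *
          ∫⁻ u, ENNReal.ofReal (Real.exp (ℓ u - ρ * ∑ k, |u k|)) ∂slabMeasure S := by gcongr
    _ ≤ ∫⁻ u, ENNReal.ofReal (Real.exp (ℓ u)) ∂columnPrior π ρ := by
        rw [hsum]
        exact Finset.single_le_sum (f := fun δ => ENNReal.ofReal (π δ * (ρ / 2) ^ δ.card) *
          ∫⁻ u, ENNReal.ofReal (Real.exp (ℓ u - ρ * ∑ k, |u k|)) ∂slabMeasure δ)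
          (fun _ _ => zero_le) (Finset.mem_univ S)

lemma measurable_l0 : Measurable (l0 : (Fin p → ℝ) → ℕ) := by
  unfold l0
  simp_rw [Finset.card_filter]
  refine Finset.measurable_sum _ fun k _ => Measurable.ite ?_ measurable_const measurable_const
  exact (measurableSet_eq_fun (measurable_pi_apply k) measurable_const).compl

lemma measurableSet_lt_l0 (a : ℝ) : MeasurableSet {u : Fin p → ℝ | a < l0 u} :=
  measurableSet_lt measurable_const ((measurable_of_countable Nat.cast).comp measurable_l0)

end ColumnPrior

/-! ### Growth of the sparsity prior -/

section Growth

variable {p s t : ℕ} {β : ℝ} {w : ℕ → ℝ}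

lemma le_exp_mul_of_succ_le (h : ∀ t < p, w (t + 1) ≤ Real.exp (-β) * w t) (hst : s ≤ t)
    (htp : t ≤ p) : w t ≤ Real.exp (-(β * (t - s))) * w s := by
  induction t, hst using Nat.le_induction with
  | base => simp
  | succ t _ ih =>
    calc w (t + 1) ≤ Real.exp (-β) * w t := h t htp
      _ ≤ Real.exp (-β) * (Real.exp (-(β * (t - s))) * w s) := by
        gcongr
        exact ih (by omega)
      _ = Real.exp (-(β * ((t + 1 : ℕ) - s))) * w s := by
        rw [← mul_assoc, ← Real.exp_add]
        push_cast
        ring_nf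

lemma sum_tail_le_of_succ_le {a : ℝ} (hβ : 0 ≤ β)
    (h : ∀ t < p, w (t + 1) ≤ Real.exp (-β) * w t) (hw : 0 ≤ w s) (hs : (s : ℝ) ≤ a) :
    ∑ t ∈ Finset.range (p + 1) with a < (t : ℕ), w t ≤ p * (Real.exp (-(β * (a - s))) * w s) := by
  have hsub : {t ∈ Finset.range (p + 1) | a < (t : ℕ)} ⊆ Finset.Ioc s p := fun t ht => by
    obtain ⟨htp, hat⟩ := Finset.mem_filter.1 ht
    exact Finset.mem_Ioc.2 ⟨by exact_mod_cast hs.trans_lt hat, Finset.mem_range_succ_iff.1 htp⟩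
  have hterm : ∀ t ∈ {t ∈ Finset.range (p + 1) | a < (t : ℕ)},
      w t ≤ Real.exp (-(β * (a - s))) * w s := fun t ht => by
    obtain ⟨hst, htp⟩ := Finset.mem_Ioc.1 (hsub ht)
    have hat := (Finset.mem_filter.1 ht).2.le
    exact (le_exp_mul_of_succ_le h hst.le htp).trans (by gcongr)
  have hcard := (Finset.card_le_card hsub).trans_eq (Nat.card_Ioc s p)
  refine (Finset.sum_le_card_nsmul _ _ _ hterm).trans ?_
  rw [nsmul_eq_mul]
  gcongr
  exact hcard.trans (Nat.sub_le p s)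

lemma sum_range_le_of_succ_le (hβ : 0 ≤ β) (h : ∀ t < p, w (t + 1) ≤ Real.exp (-β) * w t)
    (hw : 0 ≤ w 0) : ∑ t ∈ Finset.range (p + 1), w t ≤ (p + 1) * w 0 := by
  have hterm : ∀ t ∈ Finset.range (p + 1), w t ≤ w 0 := fun t ht =>
    (le_exp_mul_of_succ_le h t.zero_le (Finset.mem_range_succ_iff.1 ht)).trans <|
      mul_le_of_le_one_left hw <| Real.exp_le_one_iff.2 <| by
        rw [Nat.cast_zero, sub_zero, neg_nonpos]
        positivity
  simpa using Finset.sum_le_card_nsmul _ _ _ hterm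

end Growth

/-- The lower bound on the dimension: `p` is large enough for the growth conditions on the sparsity
prior to beat the factors `4^{|δ|}` and the constants `c₁`, `c₂`, at the cost of a quarter of the
exponent `c₄` and of one unit in the exponent `c₃`. -/
structure IsLargeDimension (c₁ c₂ c₃ c₄ : ℝ) (p : ℕ) : Prop where
  two_le : 2 ≤ p
  one_le_log : 1 ≤ Real.log p
  decay : 4 * (c₂ / (p : ℝ) ^ c₄) ≤ Real.exp (-(3 / 4 * c₄ * Real.log p))
  growth : Real.exp (-((c₃ + 1) * Real.log p)) ≤ c₁ / (p : ℝ) ^ c₃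

lemma eventually_isLargeDimension {c₁ c₂ c₄ : ℝ} (hc₁ : 0 < c₁) (hc₂ : 0 < c₂) (c₃ : ℝ)
    (hc₄ : 0 < c₄) : ∀ᶠ p : ℕ in Filter.atTop, IsLargeDimension c₁ c₂ c₃ c₄ p := by
  have hlog : Filter.Tendsto (fun p : ℕ => Real.log p) .atTop .atTop :=
    Real.tendsto_log_atTop.comp tendsto_natCast_atTop_atTop
  filter_upwards [Filter.eventually_ge_atTop 2, hlog.eventually_ge_atTop 1,
    hlog.eventually_ge_atTop (4 * Real.log (4 * c₂) / c₄),
    hlog.eventually_ge_atTop (-Real.log c₁)] with p hp hL hL₂ hL₁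
  have hpow (c : ℝ) : (p : ℝ) ^ c = Real.exp (c * Real.log p) := by
    rw [Real.rpow_def_of_pos (by positivity), mul_comm]
  refine ⟨hp, hL, ?_, ?_⟩
  · rw [hpow, ← mul_div_assoc, div_le_iff₀ (Real.exp_pos _), ← Real.exp_add,
      ← Real.log_le_iff_le_exp (by positivity)]
    linarith [(div_le_iff₀ hc₄).1 hL₂]
  · rw [hpow, le_div_iff₀ (Real.exp_pos _), ← Real.exp_add, ← Real.le_log_iff_exp_le hc₁]
    linarith

namespace SparsityPrior

variable {c₁ c₂ c₃ c₄ : ℝ} {p : ℕ} {π : Finset (Fin p) → ℝ}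

lemma exists_sizeWeight (hπ : SparsityPrior c₁ c₂ c₃ c₄ p π)
    (hp : IsLargeDimension c₁ c₂ c₃ c₄ p) :
    ∃ g : ℕ → ℝ, (∀ s ≤ p, 0 < g s) ∧
      (∀ t < p, g (t + 1) * 4 ^ (t + 1) ≤
        Real.exp (-(3 / 4 * c₄ * Real.log p)) * (g t * 4 ^ t)) ∧
      (∀ t < p, Real.exp (-((c₃ + 1) * Real.log p)) * g t ≤ g (t + 1)) ∧
      ∀ δ, π δ = g δ.card / (p.choose δ.card : ℝ) := by
  obtain ⟨g, hg, hsum, hratio, hπg⟩ := hπ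
  have hdecay : ∀ t < p, g (t + 1) * 4 ^ (t + 1) ≤
      Real.exp (-(3 / 4 * c₄ * Real.log p)) * (g t * 4 ^ t) := fun t ht => by
    have hgt := hg t ht.le
    calc g (t + 1) * 4 ^ (t + 1) ≤ c₂ / (p : ℝ) ^ c₄ * g t * 4 ^ (t + 1) := by
          gcongr
          exact (hratio (t + 1) (by omega) ht).2
      _ = 4 * (c₂ / (p : ℝ) ^ c₄) * (g t * 4 ^ t) := by ring
      _ ≤ _ := by
          gcongr
          exact hp.decay
  have hgrowth : ∀ t < p, Real.exp (-((c₃ + 1) * Real.log p)) * g t ≤ g (t + 1) := fun t ht =>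
    (mul_le_mul_of_nonneg_right hp.growth (hg t ht.le)).trans (hratio (t + 1) (by omega) ht).1
  have hzero : 0 < g 0 := by
    refine (hg 0 p.zero_le).lt_of_ne fun h0 => ?_
    have hvanish : ∀ t ∈ Finset.range (p + 1), g t = 0 := fun t ht => by
      have htp := Finset.mem_range_succ_iff.1 ht
      have hle := le_exp_mul_of_succ_le (w := fun t => g t * 4 ^ t) hdecay t.zero_le htp
      simp only [← h0, zero_mul, mul_zero] at hle
      exact (nonpos_of_mul_nonpos_left hle (by positivity)).antisymm (hg t htp)
    rw [Finset.sum_eq_zero hvanish] at hsum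
    exact zero_ne_one hsum
  have hpos : ∀ s ≤ p, 0 < g s := fun s hs => by
    induction s with
    | zero => exact hzero
    | succ s ih => exact (mul_pos (Real.exp_pos _) (ih (by omega))).trans_le (hgrowth s hs)
  exact ⟨g, hpos, hdecay, hgrowth, hπg⟩

lemma pos (hπ : SparsityPrior c₁ c₂ c₃ c₄ p π) (hp : IsLargeDimension c₁ c₂ c₃ c₄ p)
    (δ : Finset (Fin p)) : 0 < π δ := by
  obtain ⟨g, hpos, -, -, hπg⟩ := hπ.exists_sizeWeight hp
  have hδ : δ.card ≤ p := card_finset_fin_le δ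
  rw [hπg]
  exact div_pos (hpos _ hδ) (Nat.cast_pos.2 (Nat.choose_pos hδ))

end SparsityPrior

lemma sum_filter_card_mul_four_pow {p : ℕ} {π : Finset (Fin p) → ℝ} {g : ℕ → ℝ}
    (hπ : ∀ δ, π δ = g δ.card / (p.choose δ.card : ℝ)) (Q : ℕ → Prop) [DecidablePred Q] :
    ∑ δ with Q δ.card, π δ * 4 ^ δ.card = ∑ t ∈ Finset.range (p + 1) with Q t, g t * 4 ^ t := by
  have hcount := Finset.sum_powerset_apply_card
    (f := fun t => if Q t then g t / (p.choose t : ℝ) * (4 : ℝ) ^ t else 0)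
    (x := (Finset.univ : Finset (Fin p)))
  simp only [Finset.powerset_univ, Finset.card_univ, Fintype.card_fin] at hcount
  simp_rw [Finset.sum_filter, hπ, hcount]
  refine Finset.sum_congr rfl fun t ht => ?_
  have hchoose : (p.choose t : ℝ) ≠ 0 :=
    Nat.cast_ne_zero.2 (Nat.choose_pos (Finset.mem_range_succ_iff.1 ht)).ne'
  split_ifs
  · rw [nsmul_eq_mul]
    field_simp
  · simp

lemma le_exp_mul_div_choose {p s : ℕ} (hs : s ≤ p) {a : ℝ} (ha : 0 ≤ a) :
    a ≤ Real.exp (s * Real.log p) * (a / (p.choose s : ℝ)) := by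
  have hchoose : (0 : ℝ) < p.choose s := Nat.cast_pos.2 (Nat.choose_pos hs)
  have hle : (p.choose s : ℝ) ≤ Real.exp (s * Real.log p) := by
    rcases p.eq_zero_or_pos with rfl | hp
    · simp [Nat.le_zero.1 hs]
    · rw [Real.exp_nat_mul, Real.exp_log (Nat.cast_pos.2 hp)]
      exact_mod_cast Nat.choose_le_pow p s
  calc a = p.choose s * (a / (p.choose s : ℝ)) := by field_simp
    _ ≤ _ := by gcongr

namespace SparsityPrior

variable {c₁ c₂ c₃ c₄ : ℝ} {p : ℕ} {π : Finset (Fin p) → ℝ}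

lemma sum_dense_le (hπ : SparsityPrior c₁ c₂ c₃ c₄ p π) (hp : IsLargeDimension c₁ c₂ c₃ c₄ p)
    (hc₄ : 0 ≤ c₄) {S : Finset (Fin p)} {a : ℝ} (hS : S.card ≤ a) :
    ∑ δ with a < (δ.card : ℕ), π δ * 4 ^ δ.card ≤
      Real.exp ((S.card + 1) * Real.log p + Real.log 4 * S.card -
        3 / 4 * c₄ * Real.log p * (a - S.card)) * π S := by
  obtain ⟨g, hpos, hdecay, -, hπg⟩ := hπ.exists_sizeWeight hp
  have hSp : S.card ≤ p := card_finset_fin_le S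
  have hβ : 0 ≤ 3 / 4 * c₄ * Real.log p := mul_nonneg (by positivity) (Real.log_natCast_nonneg p)
  have hgS := hpos _ hSp
  have hp0 : (0 : ℝ) < p := Nat.cast_pos.2 (by have := hp.two_le; omega)
  rw [sum_filter_card_mul_four_pow hπg fun t => a < (t : ℝ)]
  refine (sum_tail_le_of_succ_le hβ hdecay (by positivity) hS).trans ?_
  calc (p : ℝ) * (Real.exp (-(3 / 4 * c₄ * Real.log p * (a - S.card))) * (g S.card * 4 ^ S.card))
      ≤ p * (Real.exp (-(3 / 4 * c₄ * Real.log p * (a - S.card))) *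
          (Real.exp (S.card * Real.log p) * π S * 4 ^ S.card)) := by
        rw [hπg]
        gcongr
        exact le_exp_mul_div_choose hSp hgS.le
    _ = Real.exp (Real.log p) * (Real.exp (-(3 / 4 * c₄ * Real.log p * (a - S.card))) *
          (Real.exp (S.card * Real.log p) * π S * Real.exp (S.card * Real.log 4))) := by
        rw [Real.exp_log hp0, Real.exp_nat_mul (Real.log 4), Real.exp_log four_pos]
    _ = _ := by
        simp only [sub_eq_add_neg, Real.exp_add, add_mul, one_mul, mul_comm (Real.log 4)]
        ring

lemma sum_le (hπ : SparsityPrior c₁ c₂ c₃ c₄ p π) (hp : IsLargeDimension c₁ c₂ c₃ c₄ p)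
    (hc₄ : 0 ≤ c₄) (S : Finset (Fin p)) :
    ∑ δ, π δ * 4 ^ δ.card ≤
      Real.exp (2 * Real.log p + (c₃ + 2) * Real.log p * S.card) * π S := by
  obtain ⟨g, hpos, hdecay, hgrowth, hπg⟩ := hπ.exists_sizeWeight hp
  have hSp : S.card ≤ p := card_finset_fin_le S
  have hβ : 0 ≤ 3 / 4 * c₄ * Real.log p := mul_nonneg (by positivity) (Real.log_natCast_nonneg p)
  have hp2 : (2 : ℝ) ≤ p := by exact_mod_cast hp.two_le
  have hsq : (p : ℝ) + 1 ≤ Real.exp (2 * Real.log p) := by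
    rw [two_mul, Real.exp_add, Real.exp_log (by positivity)]
    nlinarith
  have hzero : g 0 ≤ Real.exp ((c₃ + 1) * Real.log p * S.card) * g S.card := by
    have hlow := le_exp_mul_of_succ_le (w := -g) (s := 0)
      (fun t ht => by simpa using hgrowth t ht) S.card.zero_le hSp
    simp only [Pi.neg_apply, mul_neg, neg_le_neg_iff, Nat.cast_zero, sub_zero] at hlow
    calc g 0 = Real.exp ((c₃ + 1) * Real.log p * S.card) *
          (Real.exp (-((c₃ + 1) * Real.log p * S.card)) * g 0) := by
            rw [← mul_assoc, ← Real.exp_add, add_neg_cancel, Real.exp_zero, one_mul]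
      _ ≤ _ := by gcongr
  have hall := sum_filter_card_mul_four_pow hπg fun _ => True
  simp only [Finset.filter_true] at hall
  calc ∑ δ, π δ * 4 ^ δ.card ≤ (p + 1) * (g 0 * 4 ^ 0) :=
        hall.trans_le (sum_range_le_of_succ_le (w := fun t => g t * 4 ^ t) hβ hdecay
          (by simpa using (hpos 0 p.zero_le).le))
    _ ≤ Real.exp (2 * Real.log p) * (Real.exp ((c₃ + 1) * Real.log p * S.card) *
          (Real.exp (S.card * Real.log p) * π S)) := by
        rw [pow_zero, mul_one, hπg]
        gcongr
        · exact (hpos 0 p.zero_le).le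
        · exact hzero.trans (by gcongr; exact le_exp_mul_div_choose hSp (hpos _ hSp).le)
    _ = _ := by
        rw [← mul_assoc, ← mul_assoc, ← Real.exp_add, ← Real.exp_add]
        ring_nf

end SparsityPrior

/-! ### Factorization of the quasi-posterior over the columns -/

lemma withDensity_pi {n : ℕ} {E : Type*} [MeasurableSpace E] (μ : Fin n → Measure E)
    [∀ i, SigmaFinite (μ i)] {f : Fin n → E → ℝ≥0∞} (hf : ∀ i, Measurable (f i))
    [∀ i, SigmaFinite ((μ i).withDensity (f i))] :
    (Measure.pi μ).withDensity (fun x => ∏ i, f i (x i)) =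
      Measure.pi fun i => (μ i).withDensity (f i) := by
  refine (Measure.pi_eq fun s hs => ?_).symm
  rw [withDensity_apply _ (.univ_pi hs), Measure.restrict_pi_pi, lintegral_fin_prod_eq_prod _ hf]
  exact Finset.prod_congr rfl fun i _ => (withDensity_apply _ (hs i)).symm

lemma withDensity_map {α β : Type*} [MeasurableSpace α] [MeasurableSpace β] {μ : Measure α}
    {e : α → β} {f : β → ℝ≥0∞} (he : Measurable e) (hf : Measurable f) :
    (μ.map e).withDensity f = (μ.withDensity (f ∘ e)).map e := by
  ext s hs
  rw [withDensity_apply _ hs, Measure.map_apply he hs, withDensity_apply _ (he hs),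
    setLIntegral_map hs hf he]
  rfl

section ColumnPosterior

variable {n p : ℕ} {π : Finset (Fin p) → ℝ} {ρ : ℝ} {z : Fin n → Fin p → Fin 2}

/-- The unnormalised quasi-posterior of the `j`-th column; the quasi-posterior is the product of
these measures over `j`, up to normalisation. -/
noncomputable def columnPosteriorUnnorm (π : Finset (Fin p) → ℝ) (ρ : ℝ)
    (z : Fin n → Fin p → Fin 2) (j : Fin p) : Measure (Fin p → ℝ) :=
  (columnPrior π ρ).withDensity fun u =>
    ENNReal.ofReal (Real.exp (logisticLogLik (covariates z j) (response z j) u))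

lemma measurable_logisticLogLik {ι κ : Type*} [Fintype ι] [Fintype κ] (x : ι → κ → ℝ)
    (y : ι → ℝ) : Measurable (logisticLogLik x y) := by
  unfold logisticLogLik logPartition dotProduct
  fun_prop

lemma dotProduct_withIntercept (u : Fin p → ℝ) (j : Fin p) (x : Fin p → Fin 2) :
    u ⬝ᵥ withIntercept j x = u j + ∑ k with k ≠ j, u k * ((x k).val : ℝ) := by
  rw [dotProduct, ← Finset.add_sum_erase _ _ (Finset.mem_univ j), withIntercept,
    Function.update_self, mul_one, ← Finset.filter_ne']
  congr 1
  refine Finset.sum_congr rfl fun k hk => ?_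
  rw [Function.update_of_ne (Finset.mem_filter.1 hk).2]

lemma quasiLikelihood_eq_prod (θ : Matrix (Fin p) (Fin p) ℝ) (z : Fin n → Fin p → Fin 2) :
    quasiLikelihood θ z =
      ∏ j, Real.exp (logisticLogLik (covariates z j) (response z j) (θ.col j)) := by
  refine Finset.prod_congr rfl fun j _ => ?_
  rw [logisticLogLik, Real.exp_sum]
  refine Finset.prod_congr rfl fun i _ => ?_
  rw [Real.exp_sub, logPartition, Real.exp_log (by positivity), covariates,
    dotProduct_withIntercept, response]
  rfl

lemma logisticLogLik_response_nonpos (z : Fin n → Fin p → Fin 2) (j : Fin p) (u : Fin p → ℝ) :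
    logisticLogLik (covariates z j) (response z j) u ≤ 0 := by
  refine Finset.sum_nonpos fun i _ => ?_
  set a := u ⬝ᵥ covariates z j i
  have hnonneg : 0 ≤ logPartition a := Real.log_nonneg (by linarith [Real.exp_pos a])
  have hle : a ≤ logPartition a := (Real.le_log_iff_exp_le (by positivity)).2 (by linarith)
  rw [response]
  rcases Fin.exists_fin_two.1 ⟨z i j, rfl⟩ with h | h
  · simpa [spinVector, h] using hnonneg
  · simpa [spinVector, h] using hle

lemma isFiniteMeasure_columnPrior (hπ : ∀ δ, 0 ≤ π δ) (hρ : 0 < ρ) :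
    IsFiniteMeasure (columnPrior π ρ) := by
  have hle := setLIntegral_columnPrior_exp_le (ℓ := fun _ => 0) (v := 0) (K := 0)
    (A := Finset.univ) hπ hρ measurable_const .univ
    (fun u _ => by
      have hnorm : 0 ≤ ρ * ∑ k, |u k| := by positivity
      simp only [sub_zero]
      linarith) (by simp)
  simp only [Real.exp_zero, ENNReal.ofReal_one, setLIntegral_one] at hle
  exact ⟨hle.trans_lt ENNReal.ofReal_lt_top⟩

lemma isFiniteMeasure_columnPosteriorUnnorm (hπ : ∀ δ, 0 ≤ π δ) (hρ : 0 < ρ)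
    (z : Fin n → Fin p → Fin 2) (j : Fin p) :
    IsFiniteMeasure (columnPosteriorUnnorm π ρ z j) := by
  have := isFiniteMeasure_columnPrior hπ hρ
  refine isFiniteMeasure_withDensity (ne_top_of_le_ne_top
    (measure_ne_top (columnPrior π ρ) Set.univ) ?_)
  rw [← lintegral_one]
  exact lintegral_mono fun u => ENNReal.ofReal_le_one.2
    (Real.exp_le_one_iff.2 (logisticLogLik_response_nonpos z j u))

lemma measurable_of_col : Measurable fun col : Fin p → Fin p → ℝ =>
    (Matrix.of fun k j => col j k : Matrix (Fin p) (Fin p) ℝ) :=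
  measurable_pi_lambda _ fun k => measurable_pi_lambda _ fun j => by
    exact (measurable_pi_apply k).comp (measurable_pi_apply j)

lemma measurable_col (j : Fin p) : Measurable fun θ : Matrix (Fin p) (Fin p) ℝ => θ.col j :=
  measurable_pi_lambda _ fun k => (measurable_pi_apply j).comp (measurable_pi_apply k)

lemma quasiPosteriorUnnorm_eq_map (hπ : ∀ δ, 0 ≤ π δ) (hρ : 0 < ρ) (z : Fin n → Fin p → Fin 2) :
    quasiPosteriorUnnorm π ρ z =
      (Measure.pi (columnPosteriorUnnorm π ρ z)).map fun col => Matrix.of fun k j => col j k := by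
  have := isFiniteMeasure_columnPrior hπ hρ
  have := isFiniteMeasure_columnPosteriorUnnorm hπ hρ z
  have hlik (j : Fin p) : Measurable fun u => ENNReal.ofReal
      (Real.exp (logisticLogLik (covariates z j) (response z j) u)) :=
    (measurable_logisticLogLik _ _).exp.ennreal_ofReal
  have hprod (θ : Matrix (Fin p) (Fin p) ℝ) : ENNReal.ofReal (quasiLikelihood θ z) =
      ∏ j, ENNReal.ofReal
        (Real.exp (logisticLogLik (covariates z j) (response z j) (θ.col j))) := by
    rw [quasiLikelihood_eq_prod, ENNReal.ofReal_prod_of_nonneg fun _ _ => (Real.exp_pos _).le]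
  unfold columnPosteriorUnnorm at this ⊢
  simp_rw [quasiPosteriorUnnorm, hprod, matrixPrior]
  rw [← withDensity_pi _ hlik]
  exact withDensity_map measurable_of_col
    (Finset.measurable_prod _ fun j _ => (hlik j).comp (measurable_col j))

lemma quasiPosteriorUnnorm_col (hπ : ∀ δ, 0 ≤ π δ) (hρ : 0 < ρ) (z : Fin n → Fin p → Fin 2)
    (j : Fin p) {B : Set (Fin p → ℝ)} (hB : MeasurableSet B) :
    quasiPosteriorUnnorm π ρ z {θ | θ.col j ∈ B} =
      (∏ i ∈ Finset.univ.erase j, columnPosteriorUnnorm π ρ z i Set.univ) *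
        columnPosteriorUnnorm π ρ z j B := by
  have := isFiniteMeasure_columnPosteriorUnnorm hπ hρ z
  rw [quasiPosteriorUnnorm_eq_map hπ hρ, ← smul_eq_mul, ← Measure.smul_apply,
    ← Measure.pi_map_eval, Measure.map_apply (measurable_pi_apply j) hB]
  exact Measure.map_apply measurable_of_col (measurable_col j hB)

lemma quasiPosterior_col (hπ : ∀ δ, 0 ≤ π δ) (hρ : 0 < ρ)
    (hpos : ∀ i, columnPosteriorUnnorm π ρ z i Set.univ ≠ 0) (j : Fin p) {B : Set (Fin p → ℝ)}
    (hB : MeasurableSet B) :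
    quasiPosterior π ρ z {θ | θ.col j ∈ B} =
      columnPosteriorUnnorm π ρ z j B / columnPosteriorUnnorm π ρ z j Set.univ := by
  have := isFiniteMeasure_columnPosteriorUnnorm hπ hρ z
  have huniv := quasiPosteriorUnnorm_col hπ hρ z j .univ
  simp only [Set.mem_univ, Set.ofPred_true] at huniv
  rw [quasiPosterior, Measure.smul_apply, smul_eq_mul, quasiPosteriorUnnorm_col hπ hρ z j hB, huniv,
    mul_comm, ← div_eq_mul_inv]
  exact ENNReal.mul_div_mul_left _ _ (Finset.prod_ne_zero_iff.2 fun i _ => hpos i)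
    (ENNReal.prod_ne_top fun i _ => measure_ne_top _ _)

lemma quasiPosterior_le_one (π : Finset (Fin p) → ℝ) (ρ : ℝ) (z : Fin n → Fin p → Fin 2)
    (A : Set (Matrix (Fin p) (Fin p) ℝ)) : quasiPosterior π ρ z A ≤ 1 := by
  rw [quasiPosterior, Measure.smul_apply, smul_eq_mul]
  exact (mul_le_mul_right (measure_mono (Set.subset_univ A)) _).trans (ENNReal.inv_mul_le_one _)

lemma le_columnPosteriorUnnorm_univ {θ : Matrix (Fin p) (Fin p) ℝ} {r : ℝ}
    (hz : RegularData θ (ρ / 2) r z) (hρ : 0 < ρ) (π : Finset (Fin p) → ℝ) (j : Fin p) :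
    ENNReal.ofReal (π {k | θ k j ≠ 0} * Real.exp
      (penalizedLogLik (covariates z j) (response z j) ρ (θ.col j) -
        (3 / 2 * colSparsity θ j + n * (colSparsity θ j : ℝ) ^ 2 / (2 * ρ ^ 2)))) ≤
      columnPosteriorUnnorm π ρ z j Set.univ := by
  rw [columnPosteriorUnnorm, withDensity_apply _ .univ, Measure.restrict_univ]
  refine le_lintegral_columnPrior_exp (v := θ.col j) hρ (measurable_logisticLogLik _ _)
    fun u hu => ?_
  have hsum : ∑ k, |(u - θ.col j) k| ≤ colSparsity θ j / ρ :=
    (sum_abs_sub_le_of_mem_sparseBox (by simp) hu).trans_eq (mul_one_div _ _)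
  have hle := le_penalizedLogLik (fun i k => abs_withIntercept_le_one j k (z i)) hρ
    (hz.abs_score_le j) hsum
  rwa [Fintype.card_fin] at hle

lemma columnPosteriorUnnorm_div_le {θ : Matrix (Fin p) (Fin p) ℝ} {r : ℝ}
    (hz : RegularData θ (ρ / 2) r z) (hρ : 0 < ρ) (hπ : ∀ δ, 0 ≤ π δ) (j : Fin p)
    {B : Set (Fin p → ℝ)} (hB : MeasurableSet B) {E G : ℝ}
    (hlik : ∀ u ∈ B, penalizedLogLik (covariates z j) (response z j) ρ u ≤
      penalizedLogLik (covariates z j) (response z j) ρ (θ.col j) -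
        ρ / 4 * ∑ k, |(u - θ.col j) k| + E)
    {A : Finset (Finset (Fin p))} (hA : ∀ δ ∉ A, slabMeasure δ B = 0)
    (hprior : ∑ δ ∈ A, π δ * 4 ^ δ.card ≤ Real.exp G * π {k | θ k j ≠ 0}) :
    columnPosteriorUnnorm π ρ z j B / columnPosteriorUnnorm π ρ z j Set.univ ≤
      ENNReal.ofReal (Real.exp (E + G + (3 / 2 * colSparsity θ j +
        n * (colSparsity θ j : ℝ) ^ 2 / (2 * ρ ^ 2)))) := by
  set W := penalizedLogLik (covariates z j) (response z j) ρ (θ.col j)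
  set c := 3 / 2 * (colSparsity θ j : ℝ) + n * (colSparsity θ j : ℝ) ^ 2 / (2 * ρ ^ 2)
  refine ENNReal.div_le_of_le_mul ?_
  calc columnPosteriorUnnorm π ρ z j B
      ≤ ENNReal.ofReal (Real.exp (W + E) * ∑ δ ∈ A, π δ * 4 ^ δ.card) := by
        rw [columnPosteriorUnnorm, withDensity_apply _ hB]
        exact setLIntegral_columnPrior_exp_le hπ hρ (measurable_logisticLogLik _ _) hB
          (fun u hu => (hlik u hu).trans_eq (sub_add_eq_add_sub _ _ _)) hA
    _ ≤ ENNReal.ofReal (Real.exp (W + E) * (Real.exp G * π {k | θ k j ≠ 0})) := by gcongr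
    _ = ENNReal.ofReal (Real.exp (E + G + c)) *
          ENNReal.ofReal (π {k | θ k j ≠ 0} * Real.exp (W - c)) := by
        rw [← ENNReal.ofReal_mul (Real.exp_pos _).le, ← mul_assoc, ← Real.exp_add,
          mul_left_comm, ← Real.exp_add, mul_comm]
        ring_nf
    _ ≤ _ := by gcongr; exact le_columnPosteriorUnnorm_univ hz hρ π j

end ColumnPosterior

/-! ### Sparsity levels and sample size -/

section Levels

variable {p : ℕ} {c₄ : ℝ} {θ : Matrix (Fin p) (Fin p) ℝ}

lemma mul_zeta_sub_colSparsity (hc₄ : c₄ ≠ 0) (hp : Real.log p ≠ 0) (j : Fin p) :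
    c₄ * Real.log p * (zeta c₄ θ j - colSparsity θ j) =
      4 * Real.log p + 2 * (Real.log p + (4608 / kappaCone θ).toReal * Real.log p +
        colSparsity θ j / (64 * Real.log p) + Real.log 4 + 1) * colSparsity θ j := by
  rw [zeta, Real.log_mul four_ne_zero (Real.exp_ne_zero 1), Real.log_exp]
  field_simp
  ring

lemma add_sq_colSparsity_div_le (hc₄ : 0 < c₄) (hp : 0 < Real.log p) (j : Fin p) :
    4 * Real.log p + (colSparsity θ j : ℝ) ^ 2 / (32 * Real.log p) ≤
      c₄ * Real.log p * (zeta c₄ θ j - colSparsity θ j) := by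
  have hlog : 0 < Real.log 4 := Real.log_pos (by norm_num)
  have hsq : (colSparsity θ j : ℝ) ^ 2 / (32 * Real.log p) =
      2 * (colSparsity θ j / (64 * Real.log p)) * colSparsity θ j := by
    field_simp
    ring
  rw [mul_zeta_sub_colSparsity hc₄.ne' hp.ne', hsq]
  gcongr
  have : 0 ≤ (4608 / kappaCone θ).toReal * Real.log p := by positivity
  linarith

lemma colSparsity_le_zeta (hc₄ : 0 < c₄) (hp : 0 < Real.log p) (j : Fin p) :
    (colSparsity θ j : ℝ) ≤ zeta c₄ θ j := by
  have hnonneg : 0 ≤ c₄ * Real.log p * (zeta c₄ θ j - colSparsity θ j) :=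
    le_trans (by positivity) (add_sq_colSparsity_div_le hc₄ hp j)
  exact sub_nonneg.1 (nonneg_of_mul_nonneg_right hnonneg (by positivity))

lemma colSparsity_add_zeta_le_sbar (j : Fin p) :
    colSparsity θ j + zeta c₄ θ j ≤ sbar c₄ θ j := Nat.le_ceil _

lemma colSparsity_le_sbar (hc₄ : 0 < c₄) (hp : 0 < Real.log p) (j : Fin p) :
    colSparsity θ j ≤ sbar c₄ θ j := by
  have hζ := colSparsity_le_zeta (θ := θ) hc₄ hp j
  have hs := colSparsity_add_zeta_le_sbar (c₄ := c₄) (θ := θ) j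
  rw [← Nat.cast_le (α := ℝ)]
  linarith [(colSparsity θ j).cast_nonneg (α := ℝ)]

lemma one_le_sbar (hc₄ : 0 < c₄) (hp : 0 < Real.log p) (j : Fin p) : 1 ≤ sbar c₄ θ j := by
  have hpos : 0 < c₄ * Real.log p * (zeta c₄ θ j - colSparsity θ j) :=
    lt_of_lt_of_le (by positivity) (add_sq_colSparsity_div_le hc₄ hp j)
  have hζ : (colSparsity θ j : ℝ) < zeta c₄ θ j :=
    sub_pos.1 (pos_of_mul_pos_right hpos (by positivity))
  exact Nat.one_le_ceil_iff.2 (by linarith [(colSparsity θ j).cast_nonneg (α := ℝ)])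

lemma sbar_le_sbarMax (c₄ : ℝ) (θ : Matrix (Fin p) (Fin p) ℝ) (j : Fin p) :
    sbar c₄ θ j ≤ sbarMax c₄ θ :=
  Finset.le_sup (Finset.mem_univ j)

lemma sbar_le_sum (c₄ : ℝ) (θ : Matrix (Fin p) (Fin p) ℝ) (j : Fin p) :
    (sbar c₄ θ j : ℝ) ≤ ∑ i, (sbar c₄ θ i : ℝ) :=
  Finset.single_le_sum (f := fun i => (sbar c₄ θ i : ℝ)) (fun _ _ => Nat.cast_nonneg _)
    (Finset.mem_univ j)

lemma nonempty_fin_of_log_pos (hp : 0 < Real.log p) : Nonempty (Fin p) :=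
  Fin.pos_iff_nonempty.1 (Nat.pos_of_ne_zero (by rintro rfl; simp at hp))

lemma one_le_sum_sbar (hc₄ : 0 < c₄) (hp : 0 < Real.log p) : 1 ≤ ∑ j, (sbar c₄ θ j : ℝ) := by
  obtain ⟨j⟩ := nonempty_fin_of_log_pos hp
  exact (Nat.one_le_cast.2 (one_le_sbar hc₄ hp j)).trans (sbar_le_sum c₄ θ j)

lemma kappaSparse_sbarMax_le_one (hc₄ : 0 < c₄) (hp : 0 < Real.log p) :
    kappaSparse θ (sbarMax c₄ θ) ≤ 1 := by
  obtain ⟨j⟩ := nonempty_fin_of_log_pos hp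
  exact kappaSparse_le_one ((one_le_sbar hc₄ hp j).trans (sbar_le_sbarMax c₄ θ j)) j

lemma dense_exponent_le (hc₄ : 0 < c₄) (hp : 0 < Real.log p) (j : Fin p) :
    (4608 / kappaCone θ).toReal * colSparsity θ j * Real.log p +
      ((colSparsity θ j + 1) * Real.log p + Real.log 4 * colSparsity θ j -
        3 / 4 * c₄ * Real.log p * (zeta c₄ θ j - colSparsity θ j)) +
      (3 / 2 * colSparsity θ j + (colSparsity θ j : ℝ) ^ 2 / (1152 * Real.log p)) ≤
      -(2 * Real.log p) := by
  have hζ := mul_zeta_sub_colSparsity (θ := θ) hc₄.ne' hp.ne' j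
  set s : ℝ := (colSparsity θ j : ℝ)
  set k := (4608 / kappaCone θ).toReal
  have : 0 < Real.log 4 := Real.log_pos (by norm_num)
  have hsq : s ^ 2 / (1152 * Real.log p) ≤ 3 / 2 * (s / (64 * Real.log p)) * s := by
    rw [div_le_iff₀ (by positivity)]
    field_simp
    nlinarith [sq_nonneg s]
  have hnonneg : 0 ≤ k * Real.log p * s + Real.log p * s + Real.log 4 * s := by positivity
  linarith

lemma far_exponent_le {c₃ : ℝ} (hc₃ : 0 ≤ c₃) (hc₄ : 0 < c₄) (hp : 1 ≤ Real.log p) (j : Fin p) :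
    -((c₃ + c₄ + 8) * (sbar c₄ θ j * Real.log p)) +
      (2 * Real.log p + (c₃ + 2) * Real.log p * colSparsity θ j) +
      (3 / 2 * colSparsity θ j + (colSparsity θ j : ℝ) ^ 2 / (1152 * Real.log p)) ≤
      -(2 * Real.log p) := by
  have hp0 : 0 < Real.log p := one_pos.trans_le hp
  have hle : (colSparsity θ j : ℝ) ≤ sbar c₄ θ j := by exact_mod_cast colSparsity_le_sbar hc₄ hp0 j
  have hone : (1 : ℝ) ≤ sbar c₄ θ j := by exact_mod_cast one_le_sbar (θ := θ) hc₄ hp0 j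
  have hsq := add_sq_colSparsity_div_le (θ := θ) hc₄ hp0 j
  have hζ := colSparsity_add_zeta_le_sbar (c₄ := c₄) (θ := θ) j
  set s : ℝ := (colSparsity θ j : ℝ)
  set b : ℝ := (sbar c₄ θ j : ℝ)
  set L := Real.log p
  have hs : 0 ≤ s := Nat.cast_nonneg _
  have hpen : s ^ 2 / (1152 * L) ≤ c₄ * (b * L) :=
    calc s ^ 2 / (1152 * L) ≤ s ^ 2 / (32 * L) := by gcongr; norm_num
      _ ≤ c₄ * L * (zeta c₄ θ j - s) := by linarith
      _ ≤ c₄ * L * b := by gcongr; linarith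
      _ = c₄ * (b * L) := by ring
  have hsL : (c₃ + 2) * L * s ≤ (c₃ + 2) * L * b := by gcongr
  have hsb : s ≤ b * L := hle.trans (le_mul_of_one_le_right (by linarith) hp)
  have hLb : L ≤ b * L := le_mul_of_one_le_left hp0.le hone
  linarith

end Levels

section SampleSize

variable {n p : ℕ} {c₄ : ℝ} {θ : Matrix (Fin p) (Fin p) ℝ}

lemma priorScale_sq (n p : ℕ) : priorScale n p ^ 2 = 576 * (n * Real.log p) := by
  rw [priorScale, mul_pow, Real.sq_sqrt (by positivity)]
  norm_num

lemma priorScale_pos (hn : 0 < n) (hp : 0 < Real.log p) : 0 < priorScale n p := by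
  rw [priorScale]
  positivity

lemma mul_sq_div_priorScale_sq (hn : 0 < n) (p : ℕ) (s : ℝ) :
    n * s ^ 2 / (2 * priorScale n p ^ 2) = s ^ 2 / (1152 * Real.log p) := by
  rw [priorScale_sq]
  field_simp
  ring

lemma mul_log_le_priorScale_mul (hn : 0 < n) {b K r : ℝ} (hb : 0 ≤ b) (hK : K ≤ 1) (hr : 0 ≤ r)
    (h : b * priorScale n p ≤ n * K * r) : b * Real.log p ≤ priorScale n p * r := by
  have hρ : 0 ≤ priorScale n p := by rw [priorScale]; positivity
  have hn' : (0 : ℝ) < n := Nat.cast_pos.2 hn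
  refine le_of_mul_le_mul_left ?_ hn'
  calc n * (b * Real.log p) ≤ 576 * (n * (b * Real.log p)) :=
        le_mul_of_one_le_left (by positivity) (by norm_num)
    _ = b * priorScale n p * priorScale n p := by
        rw [mul_assoc b, ← sq, priorScale_sq]
        ring
    _ ≤ n * 1 * r * priorScale n p :=
        mul_le_mul_of_nonneg_right (h.trans (by gcongr)) hρ
    _ = n * (priorScale n p * r) := by ring

/-- The sample size condition of the theorem, with `A₁ = 10⁷`. -/
structure IsLargeSample (c₄ : ℝ) (θ : Matrix (Fin p) (Fin p) ℝ) (n : ℕ) : Prop where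
  kappa_pos : 0 < kappa c₄ θ
  le_natCast : 10 ^ 7 * ((∑ j, (sbar c₄ θ j : ℝ)) / (kappa c₄ θ).toReal) ^ 2 * Real.log p ≤ n

namespace IsLargeSample

lemma toReal_kappa_pos (h : IsLargeSample c₄ θ n) (hc₄ : 0 < c₄) (hp : 0 < Real.log p) :
    0 < (kappa c₄ θ).toReal :=
  ENNReal.toReal_pos h.kappa_pos.ne' (ne_top_of_le_ne_top ENNReal.one_ne_top
    ((min_le_right _ _).trans (kappaSparse_sbarMax_le_one hc₄ hp)))

lemma pos (h : IsLargeSample c₄ θ n) (hc₄ : 0 < c₄) (hp : 0 < Real.log p) : 0 < n := by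
  have hκ := h.toReal_kappa_pos hc₄ hp
  have hS : 0 < ∑ j, (sbar c₄ θ j : ℝ) := one_pos.trans_le (one_le_sum_sbar hc₄ hp)
  exact Nat.cast_pos.1 (lt_of_lt_of_le (by positivity) h.le_natCast)

lemma mul_sq_sum_sbar_le (h : IsLargeSample c₄ θ n) (hc₄ : 0 < c₄) (hp : 0 < Real.log p) :
    10 ^ 7 * ((∑ j, (sbar c₄ θ j : ℝ)) ^ 2 * Real.log p) ≤ n * (kappa c₄ θ).toReal ^ 2 := by
  have hκ := h.toReal_kappa_pos hc₄ hp
  rw [← div_le_iff₀ (by positivity)]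
  exact le_of_eq_of_le (by field_simp) h.le_natCast

lemma priorScale_mul_le (h : IsLargeSample c₄ θ n) (hc₄ : 0 < c₄) (hp : 0 < Real.log p) {a : ℝ}
    (ha : a ≤ ∑ j, (sbar c₄ θ j : ℝ)) :
    64 * priorScale n p * a ≤ n * (kappa c₄ θ).toReal := by
  have hρ := priorScale_pos (h.pos hc₄ hp) hp
  set S := ∑ j, (sbar c₄ θ j : ℝ)
  set κ := (kappa c₄ θ).toReal
  have hsq : (64 * priorScale n p * S) ^ 2 ≤ (n * κ) ^ 2 :=
    calc (64 * priorScale n p * S) ^ 2 = n * (2359296 * (S ^ 2 * Real.log p)) := by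
          rw [mul_pow, mul_pow, priorScale_sq]
          ring
      _ ≤ n * (10 ^ 7 * (S ^ 2 * Real.log p)) := by gcongr; norm_num
      _ ≤ n * (n * κ ^ 2) :=
          mul_le_mul_of_nonneg_left (h.mul_sq_sum_sbar_le hc₄ hp) n.cast_nonneg
      _ = (n * κ) ^ 2 := by ring
  exact (mul_le_mul_of_nonneg_left ha (by positivity)).trans
    (abs_le_of_sq_le_sq' hsq (by positivity)).2

end IsLargeSample

/-- The accuracy to which the empirical information matrices are required to approximate the
Fisher information; it is small enough to lose only half of `κ` on the relevant vectors. -/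
noncomputable def infoTolerance (c₄ : ℝ) (θ : Matrix (Fin p) (Fin p) ℝ) (n : ℕ) : ℝ :=
  n * (kappa c₄ θ).toReal / (128 * ∑ j, (sbar c₄ θ j : ℝ))

/-- Data for which the quasi-posterior contracts: the scores of all columns at the true parameter
are dominated by half of the prior scale, and the information is accurate. -/
def TypicalData (c₄ : ℝ) (θ : Matrix (Fin p) (Fin p) ℝ) (z : Fin n → Fin p → Fin 2) : Prop :=
  RegularData θ (priorScale n p / 2) (infoTolerance c₄ θ n) z

lemma infoTolerance_nonneg (c₄ : ℝ) (θ : Matrix (Fin p) (Fin p) ℝ) (n : ℕ) :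
    0 ≤ infoTolerance c₄ θ n := by
  unfold infoTolerance
  positivity

lemma infoTolerance_mul_le (hc₄ : 0 < c₄) (hp : 0 < Real.log p) (n : ℕ) {a : ℝ}
    (ha : a ≤ ∑ j, (sbar c₄ θ j : ℝ)) :
    128 * (infoTolerance c₄ θ n * a) ≤ n * (kappa c₄ θ).toReal := by
  have hS : 0 < ∑ j, (sbar c₄ θ j : ℝ) := one_pos.trans_le (one_le_sum_sbar hc₄ hp)
  calc 128 * (infoTolerance c₄ θ n * a)
      ≤ 128 * (infoTolerance c₄ θ n * ∑ j, (sbar c₄ θ j : ℝ)) := by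
        gcongr
        exact infoTolerance_nonneg c₄ θ n
    _ = n * (kappa c₄ θ).toReal := by
        rw [infoTolerance]
        field_simp

lemma pow_add_pow_mul_ofReal_le (hp : 2 ≤ p) :
    ((p : ℝ≥0∞) ^ 2 + (p : ℝ≥0∞) ^ 3) * ENNReal.ofReal (2 * (1 / (p : ℝ) ^ 8)) ≤
      ENNReal.ofReal (1 / p) := by
  have hp2 : (2 : ℝ) ≤ p := by exact_mod_cast hp
  have hcast : (p : ℝ≥0∞) ^ 2 + (p : ℝ≥0∞) ^ 3 = ENNReal.ofReal ((p : ℝ) ^ 2 + (p : ℝ) ^ 3) := by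
    exact_mod_cast (ENNReal.ofReal_natCast (p ^ 2 + p ^ 3)).symm
  rw [hcast, ← ENNReal.ofReal_mul (by positivity)]
  refine ENNReal.ofReal_le_ofReal ?_
  calc ((p : ℝ) ^ 2 + (p : ℝ) ^ 3) * (2 * (1 / (p : ℝ) ^ 8))
      ≤ ((p : ℝ) ^ 3 + (p : ℝ) ^ 3) * (p * (1 / (p : ℝ) ^ 8)) := by
        gcongr <;> linarith
    _ = 2 * (1 / (p : ℝ) ^ 4) := by field_simp; ring
    _ ≤ p * (1 / (p : ℝ) ^ 4) := by gcongr
    _ ≤ p * (1 / (p : ℝ) ^ 2) := by gcongr <;> linarith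
    _ = 1 / p := by field_simp

lemma IsIsingSample.measure_not_typicalData_le {Ω : Type*} [MeasurableSpace Ω] {P : Measure Ω}
    [IsProbabilityMeasure P] {X : Fin n → Ω → Fin p → Fin 2} (hX : IsIsingSample P θ X)
    (hθ : θ.IsSymm) (hc₄ : 0 < c₄) (hp : 2 ≤ p) (hn : IsLargeSample c₄ θ n) :
    P {ω | ¬ TypicalData c₄ θ fun i => X i ω} ≤ ENNReal.ofReal (1 / p) := by
  have hp2 : (2 : ℝ) ≤ p := by exact_mod_cast hp
  have hL : 0 < Real.log p := Real.log_pos (by linarith)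
  have hn0 := hn.pos hc₄ hL
  have hS : 0 < ∑ j, (sbar c₄ θ j : ℝ) := one_pos.trans_le (one_le_sum_sbar hc₄ hL)
  have hn' : (0 : ℝ) < n := Nat.cast_pos.2 hn0
  have hscore : Real.exp (-(priorScale n p / 2) ^ 2 / (2 * n)) ≤ Real.exp (-(8 * Real.log p)) := by
    rw [Real.exp_le_exp, div_le_iff₀ (by positivity), div_pow, priorScale_sq]
    nlinarith [mul_pos hn' hL]
  have hinfo : Real.exp (-(infoTolerance c₄ θ n) ^ 2 / (2 * n)) ≤ Real.exp (-(8 * Real.log p)) := by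
    have hle := mul_le_mul_of_nonneg_left (hn.mul_sq_sum_sbar_le hc₄ hL) hn'.le
    have hnonneg : 0 ≤ n * ((∑ j, (sbar c₄ θ j : ℝ)) ^ 2 * Real.log p) := by positivity
    rw [Real.exp_le_exp, infoTolerance, neg_div, neg_le_neg_iff, div_pow, div_div,
      le_div_iff₀ (by positivity)]
    linarith
  have hη : Real.exp (-(8 * Real.log p)) = 1 / (p : ℝ) ^ 8 := by
    rw [Real.exp_neg, one_div, ← Real.log_rpow (by positivity), Real.exp_log (by positivity)]
    norm_cast
  refine (hX.measure_not_regularData_le hθ (half_pos (priorScale_pos hn0 hL)).le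
    (infoTolerance_nonneg c₄ θ n) hscore hinfo).trans ?_
  rw [hη]
  exact pow_add_pow_mul_ofReal_le hp

end SampleSize

/-! ### Contraction of the quasi-posterior -/

lemma frobNorm_sq {p : ℕ} (A : Matrix (Fin p) (Fin p) ℝ) :
    frobNorm A ^ 2 = ∑ j, ∑ k, A k j ^ 2 := by
  have htrace : (Aᵀ * A).trace = ∑ j, ∑ k, A k j ^ 2 := by
    simp only [Matrix.trace, Matrix.diag, Matrix.mul_apply, Matrix.transpose_apply, sq]
  rw [frobNorm, htrace, Real.sq_sqrt (by positivity)]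

lemma exists_mul_lt_sum_sq_of_mul_sqrt_lt_frobNorm {p : ℕ} {A : Matrix (Fin p) (Fin p) ℝ}
    {b : Fin p → ℝ} {M ε : ℝ} (hb : ∀ j, 0 ≤ b j) (hM : 0 ≤ M) (hε : 0 ≤ ε)
    (h : M * √((∑ j, b j) * ε) < frobNorm A) :
    ∃ j, M ^ 2 * (b j * ε) < ∑ k, A k j ^ 2 := by
  have hsq : ∑ j, M ^ 2 * (b j * ε) < ∑ j, ∑ k, A k j ^ 2 := by
    rw [← frobNorm_sq, ← Finset.mul_sum, ← Finset.sum_mul,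
      ← Real.sq_sqrt (mul_nonneg (Finset.sum_nonneg fun j _ => hb j) hε), ← mul_pow]
    exact pow_lt_pow_left₀ h (by positivity) two_ne_zero
  obtain ⟨j, -, hj⟩ := Finset.exists_lt_of_sum_lt hsq
  exact ⟨j, hj⟩

section Contraction

variable {n p : ℕ} {c₁ c₂ c₃ c₄ : ℝ} {π : Finset (Fin p) → ℝ} {θ : Matrix (Fin p) (Fin p) ℝ}
  {z : Fin n → Fin p → Fin 2}

lemma columnPosteriorUnnorm_univ_ne_zero {ρ r : ℝ} (hz : RegularData θ (ρ / 2) r z) (hρ : 0 < ρ)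
    (hπ : ∀ δ, 0 < π δ) (j : Fin p) : columnPosteriorUnnorm π ρ z j Set.univ ≠ 0 :=
  ((ENNReal.ofReal_pos.2 (mul_pos (hπ _) (Real.exp_pos _))).trans_le
    (le_columnPosteriorUnnorm_univ hz hρ π j)).ne'

lemma TypicalData.penalizedLogLik_le (hz : TypicalData c₄ θ z) (hc₄ : 0 < c₄)
    (hp : 0 < Real.log p) (hn : IsLargeSample c₄ θ n) (j : Fin p) (u : Fin p → ℝ) :
    penalizedLogLik (covariates z j) (response z j) (priorScale n p) u ≤
      penalizedLogLik (covariates z j) (response z j) (priorScale n p) (θ.col j) -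
        priorScale n p / 4 * ∑ k, |(u - θ.col j) k| +
        (4608 / kappaCone θ).toReal * colSparsity θ j * Real.log p := by
  have hn0 := hn.pos hc₄ hp
  have hκ := hn.toReal_kappa_pos hc₄ hp
  have hs : (colSparsity θ j : ℝ) ≤ ∑ j, (sbar c₄ θ j : ℝ) :=
    (Nat.cast_le.2 (colSparsity_le_sbar hc₄ hp j)).trans (sbar_le_sum c₄ θ j)
  obtain ⟨K, hκK, hK, hKzeta⟩ := exists_le_kappaCone (θ := θ)
    (ENNReal.ofReal_toReal_le.trans (min_le_left _ _) :
      ENNReal.ofReal (kappa c₄ θ).toReal ≤ kappaCone θ) j 4608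
  have hnκK : n * (kappa c₄ θ).toReal ≤ n * K := by gcongr
  have hK0 : 0 < K := hκ.trans_le hκK
  refine (penalizedLogLik_le_of_cone (m := n * K)
    (fun i k => abs_withIntercept_le_one j k (z i)) (priorScale_pos hn0 hp).le
    (hz.abs_score_le j) (by positivity) ((hn.priorScale_mul_le hc₄ hp hs).trans hnκK)
    (fun d => hz.half_mul_sum_sq_le_of_cone (infoTolerance_nonneg c₄ θ n) hK0 hK
      ((infoTolerance_mul_le hc₄ hp n hs).trans hnκK)) u).trans_eq ?_
  congr 1
  rw [← hKzeta, priorScale_sq]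
  change 8 * (576 * (n * Real.log p)) * (colSparsity θ j : ℝ) / (n * K) =
    (4608 : ℝ≥0∞).toReal / K * colSparsity θ j * Real.log p
  simp only [ENNReal.toReal_ofNat]
  field_simp
  ring

lemma toReal_kappaSparse_sbarMax_le_one (hc₄ : 0 < c₄) (hp : 0 < Real.log p) :
    (kappaSparse θ (sbarMax c₄ θ)).toReal ≤ 1 :=
  ENNReal.toReal_le_of_le_ofReal zero_le_one
    (ENNReal.ofReal_one.symm ▸ kappaSparse_sbarMax_le_one hc₄ hp)

lemma toReal_kappa_le_toReal_kappaSparse (hc₄ : 0 < c₄) (hp : 0 < Real.log p) :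
    (kappa c₄ θ).toReal ≤ (kappaSparse θ (sbarMax c₄ θ)).toReal :=
  ENNReal.toReal_mono (ne_top_of_le_ne_top ENNReal.one_ne_top (kappaSparse_sbarMax_le_one hc₄ hp))
    (min_le_right _ _)

lemma TypicalData.half_mul_sum_sq_le_of_l0_le_sbar (hz : TypicalData c₄ θ z) (hc₄ : 0 < c₄)
    (hp : 0 < Real.log p) (hκ : 0 < (kappa c₄ θ).toReal) {j : Fin p} {d : Fin p → ℝ}
    (hd : l0 d ≤ sbar c₄ θ j) :
    n * (kappaSparse θ (sbarMax c₄ θ)).toReal / 2 * ∑ k, d k ^ 2 ≤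
      d ⬝ᵥ (logisticInfo (covariates z j) (θ.col j) *ᵥ d) := by
  have hκK := toReal_kappa_le_toReal_kappaSparse (θ := θ) hc₄ hp
  have htol := infoTolerance_nonneg c₄ θ n
  refine hz.half_mul_sum_sq_le_of_sparse htol (hκ.trans_le hκK) ENNReal.ofReal_toReal_le
    (hd.trans (sbar_le_sbarMax c₄ θ j)) ?_
  calc 2 * (infoTolerance c₄ θ n * l0 d) ≤ 128 * (infoTolerance c₄ θ n * l0 d) := by
        gcongr
        norm_num
    _ ≤ n * (kappa c₄ θ).toReal :=
        infoTolerance_mul_le hc₄ hp n ((Nat.cast_le.2 hd).trans (sbar_le_sum c₄ θ j))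
    _ ≤ n * (kappaSparse θ (sbarMax c₄ θ)).toReal := by gcongr

lemma mul_priorScale_le_of_far (hn : 0 < n) {b K q T : ℝ} (hb : 0 ≤ b) (hK : 0 < K)
    (hfar : (24 * T / K) ^ 2 * (b * (Real.log p / n)) < q) :
    T * b * priorScale n p ≤ n * K * √(b * q) := by
  have : (0 : ℝ) < n := Nat.cast_pos.2 hn
  have hq : 0 ≤ q := le_trans (by positivity) hfar.le
  refine (abs_le_of_sq_le_sq' ?_ (by positivity)).2
  calc (T * b * priorScale n p) ^ 2
      = n ^ 2 * K ^ 2 * (b * ((24 * T / K) ^ 2 * (b * (Real.log p / n)))) := by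
        rw [mul_pow, priorScale_sq]
        field_simp
        ring
    _ ≤ n ^ 2 * K ^ 2 * (b * q) := by gcongr
    _ = (n * K * √(b * q)) ^ 2 := by rw [mul_pow, mul_pow, Real.sq_sqrt (by positivity)]

lemma TypicalData.penalizedLogLik_le_of_far (hz : TypicalData c₄ θ z) (hc₄ : 0 < c₄)
    (hp : 0 < Real.log p) (hn : IsLargeSample c₄ θ n) {T : ℝ} (hT : 48 ≤ T) {j : Fin p}
    {u : Fin p → ℝ} (hu : l0 (u - θ.col j) ≤ sbar c₄ θ j)
    (hfar : (24 * T / (kappaSparse θ (sbarMax c₄ θ)).toReal) ^ 2 *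
      (sbar c₄ θ j * (Real.log p / n)) < ∑ k, (u - θ.col j) k ^ 2) :
    penalizedLogLik (covariates z j) (response z j) (priorScale n p) u ≤
      penalizedLogLik (covariates z j) (response z j) (priorScale n p) (θ.col j) -
        priorScale n p / 4 * ∑ k, |(u - θ.col j) k| +
        -(T / 8 * (sbar c₄ θ j * Real.log p)) := by
  have hn0 := hn.pos hc₄ hp
  have hρ := priorScale_pos hn0 hp
  have hκ := hn.toReal_kappa_pos hc₄ hp
  have hK1 := toReal_kappaSparse_sbarMax_le_one (θ := θ) hc₄ hp
  have hκK := toReal_kappa_le_toReal_kappaSparse (θ := θ) hc₄ hp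
  have hcurv := hz.half_mul_sum_sq_le_of_l0_le_sbar hc₄ hp hκ hu
  set K := (kappaSparse θ (sbarMax c₄ θ)).toReal
  set q := ∑ k, (u - θ.col j) k ^ 2
  have hK : 0 < K := hκ.trans_le hκK
  have hb : (0 : ℝ) < sbar c₄ θ j := by exact_mod_cast one_le_sbar (θ := θ) hc₄ hp j
  have hq : 0 < q := lt_of_le_of_lt (by positivity) hfar
  have hbρ : 64 * priorScale n p * sbar c₄ θ j ≤ n * K :=
    (hn.priorScale_mul_le hc₄ hp (sbar_le_sum c₄ θ j)).trans (by gcongr)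
  have hrad := mul_priorScale_le_of_far hn0 hb.le hK hfar
  have hlik := penalizedLogLik_le_of_sparse (fun i k => abs_withIntercept_le_one j k (z i)) hρ.le
    (hz.abs_score_le j) (by positivity) (Nat.cast_le.2 hu) hcurv
  have hexp := sparse_exponent_le hρ.le hb (Real.sqrt_pos.2 (mul_pos hb hq))
    (Real.sq_sqrt (mul_pos hb hq).le) hT hrad hbρ
  have hmin : sbar c₄ θ j * Real.log p ≤ priorScale n p * min 1 √(sbar c₄ θ j * q) := by
    have hnonneg : 0 ≤ sbar c₄ θ j * priorScale n p := by positivity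
    rw [mul_min_of_nonneg _ _ hρ.le]
    refine le_min (mul_log_le_priorScale_mul hn0 hb.le hK1 zero_le_one (by linarith))
      (mul_log_le_priorScale_mul hn0 hb.le hK1 (Real.sqrt_nonneg _) (hrad.trans' ?_))
    rw [mul_assoc]
    exact le_mul_of_one_le_left hnonneg (by linarith)
  refine hlik.trans (add_le_add_right (hexp.trans (neg_le_neg ?_)) _)
  exact mul_le_mul_of_nonneg_left hmin (by positivity)

lemma l0_sub_le (u v : Fin p → ℝ) : l0 (u - v) ≤ l0 u + l0 v := by
  refine (Finset.card_le_card fun k hk => ?_).trans (Finset.card_union_le _ _)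
  simp only [Finset.mem_filter, Finset.mem_univ, true_and, Finset.mem_union, Pi.sub_apply] at hk ⊢
  contrapose! hk
  rw [hk.1, hk.2, sub_zero]

lemma l0_sub_col_le_sbar {j : Fin p} {u : Fin p → ℝ} (hu : l0 u ≤ zeta c₄ θ j) :
    l0 (u - θ.col j) ≤ sbar c₄ θ j := by
  have hsub : (l0 (u - θ.col j) : ℝ) ≤ l0 u + colSparsity θ j := by
    exact_mod_cast l0_sub_le u (θ.col j)
  have hsbar := colSparsity_add_zeta_le_sbar (c₄ := c₄) (θ := θ) j
  rw [← Nat.cast_le (α := ℝ)]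
  linarith

lemma TypicalData.quasiPosterior_col_dense_le (hz : TypicalData c₄ θ z) (hc₄ : 0 < c₄)
    (hp : IsLargeDimension c₁ c₂ c₃ c₄ p) (hπ : SparsityPrior c₁ c₂ c₃ c₄ p π)
    (hn : IsLargeSample c₄ θ n) (j : Fin p) :
    quasiPosterior π (priorScale n p) z {θ' | θ'.col j ∈ {u | zeta c₄ θ j < l0 u}} ≤
      ENNReal.ofReal (Real.exp (-(2 * Real.log p))) := by
  have hL : 0 < Real.log p := one_pos.trans_le hp.one_le_log
  have hn0 := hn.pos hc₄ hL
  have hρ := priorScale_pos hn0 hL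
  have hπ0 δ := hπ.pos hp δ
  rw [quasiPosterior_col (fun δ => (hπ0 δ).le) hρ
    (columnPosteriorUnnorm_univ_ne_zero hz hρ hπ0) j (measurableSet_lt_l0 _)]
  refine (columnPosteriorUnnorm_div_le hz hρ (fun δ => (hπ0 δ).le) j (measurableSet_lt_l0 _)
    (fun u _ => hz.penalizedLogLik_le hc₄ hL hn j u)
    (A := {δ | zeta c₄ θ j < (δ.card : ℕ)})
    (fun δ hδ => slabMeasure_lt_l0 (by simpa using hδ))
    (hπ.sum_dense_le hp hc₄.le (colSparsity_le_zeta hc₄ hL j))).trans ?_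
  rw [mul_sq_div_priorScale_sq hn0]
  exact ENNReal.ofReal_le_ofReal (Real.exp_le_exp.2 (dense_exponent_le hc₄ hL j))

lemma TypicalData.quasiPosterior_col_far_le (hz : TypicalData c₄ θ z) (hc₃ : 0 ≤ c₃)
    (hc₄ : 0 < c₄) (hp : IsLargeDimension c₁ c₂ c₃ c₄ p) (hπ : SparsityPrior c₁ c₂ c₃ c₄ p π)
    (hn : IsLargeSample c₄ θ n) (j : Fin p) :
    quasiPosterior π (priorScale n p) z {θ' | θ'.col j ∈ {u | l0 u ≤ zeta c₄ θ j ∧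
      (192 * (c₃ + c₄ + 8) / (kappaSparse θ (sbarMax c₄ θ)).toReal) ^ 2 *
        (sbar c₄ θ j * (Real.log p / n)) < ∑ k, (u - θ.col j) k ^ 2}} ≤
      ENNReal.ofReal (Real.exp (-(2 * Real.log p))) := by
  have hL : 0 < Real.log p := one_pos.trans_le hp.one_le_log
  have hn0 := hn.pos hc₄ hL
  have hρ := priorScale_pos hn0 hL
  have hπ0 δ := hπ.pos hp δ
  have hT : 192 * (c₃ + c₄ + 8) = 24 * (8 * (c₃ + c₄ + 8)) := by ring
  have hmeas : MeasurableSet {u : Fin p → ℝ | l0 u ≤ zeta c₄ θ j ∧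
      (192 * (c₃ + c₄ + 8) / (kappaSparse θ (sbarMax c₄ θ)).toReal) ^ 2 *
        (sbar c₄ θ j * (Real.log p / n)) < ∑ k, (u - θ.col j) k ^ 2} := by
    have hdist : Measurable fun u : Fin p → ℝ => ∑ k, (u - θ.col j) k ^ 2 := by
      simp only [Pi.sub_apply]
      fun_prop
    simp only [← not_lt (a := zeta c₄ θ j)]
    exact (measurableSet_lt_l0 _).compl.inter (measurableSet_lt measurable_const hdist)
  rw [quasiPosterior_col (fun δ => (hπ0 δ).le) hρ
    (columnPosteriorUnnorm_univ_ne_zero hz hρ hπ0) j hmeas]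
  refine (columnPosteriorUnnorm_div_le hz hρ (fun δ => (hπ0 δ).le) j hmeas
    (fun u hu => hz.penalizedLogLik_le_of_far hc₄ hL hn (by linarith) (l0_sub_col_le_sbar hu.1)
      (hT ▸ hu.2))
    (A := Finset.univ) (by simp) (hπ.sum_le hp hc₄.le _)).trans ?_
  rw [mul_sq_div_priorScale_sq hn0, mul_div_cancel_left₀ _ (by norm_num : (8 : ℝ) ≠ 0)]
  exact ENNReal.ofReal_le_ofReal
    (Real.exp_le_exp.2 (far_exponent_le hc₃ hc₄ hp.one_le_log j))

lemma natCast_mul_exp_neg_two_mul_log (hp : p ≠ 0) :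
    p * ENNReal.ofReal (Real.exp (-(2 * Real.log p))) = ENNReal.ofReal (1 / p) := by
  have hp' : (0 : ℝ) < p := by positivity
  rw [← ENNReal.ofReal_natCast, ← ENNReal.ofReal_mul hp'.le, Real.exp_neg, two_mul, Real.exp_add,
    Real.exp_log hp']
  congr 1
  field_simp

lemma TypicalData.quasiPosterior_dense_le (hz : TypicalData c₄ θ z) (hc₄ : 0 < c₄)
    (hp : IsLargeDimension c₁ c₂ c₃ c₄ p) (hπ : SparsityPrior c₁ c₂ c₃ c₄ p π)
    (hn : IsLargeSample c₄ θ n) :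
    quasiPosterior π (priorScale n p) z {θ' | ∃ j, zeta c₄ θ j < l0 (θ'.col j)} ≤
      ENNReal.ofReal (1 / p) := by
  have hunion := measure_iUnion_le_card_mul
    (fun j => hz.quasiPosterior_col_dense_le hc₄ hp hπ hn j)
  rw [Fintype.card_fin,
    natCast_mul_exp_neg_two_mul_log (two_pos.trans_le hp.two_le).ne'] at hunion
  exact (measure_mono fun θ' hθ' => Set.mem_iUnion.2 hθ').trans hunion

lemma TypicalData.quasiPosterior_far_le (hz : TypicalData c₄ θ z) (hc₃ : 0 ≤ c₃) (hc₄ : 0 < c₄)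
    (hp : IsLargeDimension c₁ c₂ c₃ c₄ p) (hπ : SparsityPrior c₁ c₂ c₃ c₄ p π)
    (hn : IsLargeSample c₄ θ n) :
    quasiPosterior π (priorScale n p) z
      {θ' | 192 * (c₃ + c₄ + 8) / (kappaSparse θ (sbarMax c₄ θ)).toReal *
        √((∑ j, (sbar c₄ θ j : ℝ)) * Real.log p / n) < frobNorm (θ' - θ)} ≤
      ENNReal.ofReal (1 / p) + ENNReal.ofReal (1 / p) := by
  have hunion := measure_iUnion_le_card_mul
    (fun j => hz.quasiPosterior_col_far_le hc₃ hc₄ hp hπ hn j)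
  rw [Fintype.card_fin,
    natCast_mul_exp_neg_two_mul_log (two_pos.trans_le hp.two_le).ne'] at hunion
  refine (measure_mono fun θ' hθ' => ?_).trans ((measure_union_le _ _).trans
    (add_le_add (hz.quasiPosterior_dense_le hc₄ hp hπ hn) hunion))
  have hε : 0 ≤ Real.log p / n := by positivity
  have hfar : 192 * (c₃ + c₄ + 8) / (kappaSparse θ (sbarMax c₄ θ)).toReal *
      √((∑ j, (sbar c₄ θ j : ℝ)) * (Real.log p / n)) < frobNorm (θ' - θ) := by
    rw [← mul_div_assoc]
    exact hθ'
  obtain ⟨j, hj⟩ := exists_mul_lt_sum_sq_of_mul_sqrt_lt_frobNorm (fun j => Nat.cast_nonneg _)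
    (by positivity) hε hfar
  rcases lt_or_ge (zeta c₄ θ j) (l0 (θ'.col j)) with hdense | hsparse
  · exact Or.inl ⟨j, hdense⟩
  · exact Or.inr (Set.mem_iUnion.2 ⟨j, hsparse, hj⟩)

lemma lintegral_quasiPosterior_le {Ω : Type*} [MeasurableSpace Ω] {P : Measure Ω}
    [IsProbabilityMeasure P] {X : Fin n → Ω → Fin p → Fin 2} (hX : ∀ i, Measurable (X i))
    {G : (Fin n → Fin p → Fin 2) → Prop} {ρ : ℝ} {A : Set (Matrix (Fin p) (Fin p) ℝ)}
    {a b : ℝ≥0∞} (hG : P {ω | ¬ G fun i => X i ω} ≤ a)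
    (h : ∀ z, G z → quasiPosterior π ρ z A ≤ b) :
    ∫⁻ ω, quasiPosterior π ρ (fun i => X i ω) A ∂P ≤ a + b := by
  have hmeas : MeasurableSet {ω | ¬ G fun i => X i ω} :=
    (measurable_pi_iff.2 hX) (Set.toFinite {z : Fin n → Fin p → Fin 2 | ¬ G z}).measurableSet
  calc ∫⁻ ω, quasiPosterior π ρ (fun i => X i ω) A ∂P
      ≤ ∫⁻ ω, ({ω | ¬ G fun i => X i ω}.indicator (fun _ => 1) ω + b) ∂P := by
        refine lintegral_mono fun ω => ?_
        by_cases hω : G fun i => X i ω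
        · exact (h _ hω).trans le_add_self
        · rw [Set.indicator_of_mem (by exact hω)]
          exact (quasiPosterior_le_one π ρ _ A).trans le_self_add
    _ = P {ω | ¬ G fun i => X i ω} + b := by
        rw [lintegral_add_right _ measurable_const, lintegral_indicator_const hmeas,
          lintegral_const, measure_univ, mul_one, one_mul]
    _ ≤ a + b := by gcongr

end Contraction

end IsingQP

theorem theorem3 :
    ∃ A₁ A₂ : ℝ, 0 < A₁ ∧ 0 < A₂ ∧
    ∀ c₁ c₂ c₃ c₄ : ℝ, 0 < c₁ → 0 < c₂ → 0 < c₄ → c₄ ≤ c₃ →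
    ∃ M₀ : ℝ, 2 < M₀ ∧ ∃ p₀ : ℕ, ∀ p : ℕ, p₀ ≤ p →
    ∀ (π : Finset (Fin p) → ℝ), SparsityPrior c₁ c₂ c₃ c₄ p π →
    ∀ (θs : Matrix (Fin p) (Fin p) ℝ), θs.IsSymm → 0 < kappa c₄ θs →
    ∀ n : ℕ, A₁ * ((∑ j, (sbar c₄ θs j : ℝ)) / (kappa c₄ θs).toReal) ^ 2 * Real.log p ≤ (n : ℝ) →
    ∀ (Ω : Type*) [MeasurableSpace Ω] (P : Measure Ω) [IsProbabilityMeasure P]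
      (X : Fin n → Ω → Fin p → Fin 2), IsIsingSample P θs X →
      (∫⁻ ω, quasiPosterior π (priorScale n p) (fun i => X i ω)
            {θ | ∃ j, zeta c₄ θs j < (l0 fun k => θ k j : ℝ)} ∂P
          ≤ ENNReal.ofReal (Real.exp (-A₂ * n) + 4 / p)) ∧
      (∫⁻ ω, quasiPosterior π (priorScale n p) (fun i => X i ω)
            {θ | M₀ / (kappaSparse θs (sbarMax c₄ θs)).toReal *
                Real.sqrt ((∑ j, (sbar c₄ θs j : ℝ)) * Real.log p / n)
              < frobNorm (θ - θs)} ∂P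
          ≤ ENNReal.ofReal (2 * Real.exp (-A₂ * n) + 12 / p)) := by
  refine ⟨10 ^ 7, 1, by norm_num, one_pos, fun c₁ c₂ c₃ c₄ hc₁ hc₂ hc₄ hc₃₄ => ?_⟩
  have hc₃ : 0 < c₃ := hc₄.trans_le hc₃₄
  obtain ⟨p₀, hp₀⟩ := Filter.eventually_atTop.1 (eventually_isLargeDimension hc₁ hc₂ c₃ hc₄)
  refine ⟨192 * (c₃ + c₄ + 8), by linarith, p₀,
    fun p hp₀p π hπ θ hθ hκ n hn Ω _ P _ X hX => ?_⟩
  have hp := hp₀ p hp₀p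
  have hsample : IsLargeSample c₄ θ n := ⟨hκ, hn⟩
  have hatypical := hX.measure_not_typicalData_le hθ hc₄ hp.two_le hsample
  have hp_nonneg : 0 ≤ 1 / (p : ℝ) := by positivity
  have hexp := Real.exp_pos (-1 * (n : ℝ))
  constructor
  · refine (lintegral_quasiPosterior_le hX.measurable hatypical fun z hz =>
      hz.quasiPosterior_dense_le hc₄ hp hπ hsample).trans ?_
    rw [← ENNReal.ofReal_add hp_nonneg hp_nonneg]
    refine ENNReal.ofReal_le_ofReal ?_
    rw [← mul_one_div 4]
    linarith
  · refine (lintegral_quasiPosterior_le hX.measurable hatypical fun z hz =>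
      hz.quasiPosterior_far_le hc₃.le hc₄ hp hπ hsample).trans ?_
    rw [← ENNReal.ofReal_add hp_nonneg hp_nonneg,
      ← ENNReal.ofReal_add hp_nonneg (add_nonneg hp_nonneg hp_nonneg)]
    refine ENNReal.ofReal_le_ofReal ?_
    rw [← mul_one_div 12]
    linarith
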